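/- Let $n\ge 1$ and let $P\subset\mathbb{R}^n$ be an integer polytope, i.e. the non-empty interior of the convex hull $\overline P$ of a finite set of points of $\mathbb{Z}^n$. Let $h$ be a convex function in $C^2(\overline P)$. Then, as $k\to\infty$ through the positive integers, $$\sum_{p\in\overline P\cap\frac1k\mathbb{Z}^n}h(p)=\left(\int_P h\,d\mu\right)k^n+\left(\frac12\int_{\partial P}h\,d\sigma\right)k^{n-1}+O(k^{n-2}).$$ Here $\mu$ is Lebesgue measure on $\mathbb{R}^n$, and $\sigma$ is the measure on $\partial P$ defined as follows. For each facet ($(n-1)$-dimensional face) $F$ of $\overline P$ let $v_F$ be the shortest non-zero vector of $\mathbb{Z}^n$ that is perpendicular to $F$ and points inwards, and let $l_F$ be the affine function with derivative $v_F$ that vanishes on $F$. Then $\sigma_F:=\sigma|_F$ is the positive measure with $d\sigma_F\wedge dl_F=\pm d\mu$; equivalently, $\sigma_F$ is the Euclidean hypersurface measure on $F$ divided by the Euclidean length of $v_F$. -/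

import Mathlib

open MeasureTheory Filter Asymptotics

noncomputable section

namespace LatticeSum

/-! The ambient space `ℝⁿ` is `Fin n → ℝ`, with its Lebesgue measure `volume` and the dot product
`⬝ᵥ`. No norm enters the definitions. -/

/-- The integer vector `v` viewed as an element of `ℝⁿ`. -/
def toReal {n : ℕ} (v : Fin n → ℤ) : Fin n → ℝ := fun i => (v i : ℝ)

/-- `P ⊂ ℝⁿ` is an (open, full-dimensional) integer polytope: it is the nonempty interior of the
convex hull of a finite set of points of `ℤⁿ`. Its closure is that convex hull. -/
def IsIntegerPolytope {n : ℕ} (P : Set (Fin n → ℝ)) : Prop :=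
  P.Nonempty ∧ ∃ V : Finset (Fin n → ℤ),
    P = interior (convexHull ℝ (toReal '' (V : Set (Fin n → ℤ))))

/-- The lattice `(1/k) ℤⁿ` (only `k ≥ 1` is meaningful). -/
def scaledLattice (n k : ℕ) : Set (Fin n → ℝ) :=
  {x | ∃ z : Fin n → ℤ, x = fun i => (z i : ℝ) / (k : ℝ)}

/-- The affine function `l` with derivative `v` and with minimum `0` on the compact set `K`. If `v`
is the primitive inward normal of the facet `F` of the polytope `K`, this is the function `l_F`. -/
def facetFun {n : ℕ} (K : Set (Fin n → ℝ)) (v : Fin n → ℤ) (x : Fin n → ℝ) : ℝ :=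
  toReal v ⬝ᵥ x - sInf ((fun y => toReal v ⬝ᵥ y) '' K)

/-- The face `l⁻¹(0) ∩ K` of `K` with inward normal `v`. -/
def face {n : ℕ} (K : Set (Fin n → ℝ)) (v : Fin n → ℤ) : Set (Fin n → ℝ) :=
  {x ∈ K | facetFun K v x = 0}

/-- `v` is the primitive inward normal of a facet of `K`: `v` is an integer vector with coprime
coordinates (so it is the shortest nonzero integer vector on its ray), and the face of `K` with
inward normal `v` has dimension `n - 1`. -/
def IsPrimitiveFacetNormal {n : ℕ} (K : Set (Fin n → ℝ)) (v : Fin n → ℤ) : Prop :=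
  Finset.univ.gcd v = 1 ∧ (face K v).Nonempty ∧
    Module.finrank ℝ (vectorSpan ℝ (face K v)) + 1 = n

/-- The projection of `ℝⁿ` onto the hyperplane `l = 0` along `w = v / (v ⬝ v)`, where
`dl (w) = 1`. -/
def facetProj {n : ℕ} (K : Set (Fin n → ℝ)) (v : Fin n → ℤ) (x : Fin n → ℝ) : Fin n → ℝ :=
  x - (facetFun K v x / (toReal v ⬝ᵥ toReal v)) • toReal v

/-- The positive measure `σ_F` on the facet `F` with primitive inward normal `v`, determined by
`dσ_F ∧ dl_F = ± dμ`. Here `μ` is Lebesgue measure. Let `w` be a vector with `dl_F (w) = 1`. The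
relation says that `(y, t) ↦ y + t w`, from `{l_F = 0} × ℝ` to `ℝⁿ`, carries `σ × dt` to `μ`.
Restricting to `0 ≤ t ≤ 1` and projecting to the first factor gives
`σ_F (A) = μ {y + t w | y ∈ A ∩ F, 0 ≤ t ≤ 1}`, which is the measure below. (It equals the
Euclidean hypersurface measure on `F` divided by the Euclidean length of `v`.) -/
def facetMeasure {n : ℕ} (K : Set (Fin n → ℝ)) (v : Fin n → ℤ) : Measure (Fin n → ℝ) :=
  ((volume.restrict {x | 0 ≤ facetFun K v x ∧ facetFun K v x ≤ 1}).map
    (facetProj K v)).restrict (face K v)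

/-- The lattice-normalized boundary measure `σ` of the polytope `P`: the sum of the measures `σ_F`
over the facets `F` of the closure of `P`, each facet being indexed by its primitive inward
normal. Two facets meet in a set of measure zero, so the restriction of `σ` to `F` is `σ_F`. -/
def boundaryMeasure {n : ℕ} (P : Set (Fin n → ℝ)) : Measure (Fin n → ℝ) :=
  Measure.sum fun v : {v : Fin n → ℤ // IsPrimitiveFacetNormal (closure P) v} =>
    facetMeasure (closure P) v.1

/-- The index set of the sum over lattice points is finite. -/
theorem finite_closure_inter_scaledLattice {n : ℕ} {P : Set (Fin n → ℝ)}
    (hP : IsIntegerPolytope P) (k : ℕ) : (closure P ∩ scaledLattice n k).Finite := by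
  obtain ⟨-, V, rfl⟩ := hP
  have hc : IsCompact (convexHull ℝ (toReal '' (V : Set (Fin n → ℤ)))) :=
    (V.finite_toSet.image _).isCompact_convexHull ℝ
  have hsub : closure (interior (convexHull ℝ (toReal '' (V : Set (Fin n → ℤ)))))
      ⊆ convexHull ℝ (toReal '' (V : Set (Fin n → ℤ))) :=
    closure_minimal interior_subset hc.isClosed
  obtain ⟨C, hC⟩ := hc.isBounded.exists_norm_le
  refine Set.Finite.subset (Set.Finite.image
    (fun z : Fin n → ℤ => fun i => (z i : ℝ) / (k : ℝ))
    (Set.finite_Icc (fun _ : Fin n => -⌈C * k⌉) (fun _ => ⌈C * k⌉)) |>.union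
      (Set.finite_singleton (0 : Fin n → ℝ))) ?_
  rintro x ⟨hx, z, rfl⟩
  rcases Nat.eq_zero_or_pos k with rfl | hk
  · right
    ext i
    simp
  left
  refine ⟨z, ?_, rfl⟩
  have hk' : (0 : ℝ) < k := by exact_mod_cast hk
  have key : ∀ i, |(z i : ℝ)| ≤ C * k := fun i => by
    have h1 := (norm_le_pi_norm _ i).trans (hC _ (hsub hx))
    rw [Real.norm_eq_abs, abs_div, abs_of_pos hk', div_le_iff₀ hk'] at h1
    exact h1
  rw [Set.mem_Icc, Pi.le_def, Pi.le_def]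
  refine ⟨fun i => ?_, fun i => ?_⟩
  · have := (abs_le.1 (key i)).1
    have h2 := Int.le_ceil (C * (k : ℝ))
    have : (-(⌈C * (k : ℝ)⌉ : ℝ)) ≤ z i := by linarith
    exact_mod_cast this
  · exact_mod_cast ((abs_le.1 (key i)).2.trans (Int.le_ceil (C * (k : ℝ))))

end LatticeSum

end

/-!
The sum of `h` over `(1/k) ℤⁿ` in a polytope `K` is compared with the average of the same sums over
lattices displaced by `u / k` and by `-u / k`, where `u` runs through the unit cube. Since the unit
cubes at the points of `ℤⁿ` tile space, this average is exactly `kⁿ ∫ h` (`pow_mul_integral_eq`,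
`pow_mul_integral_eq_sub`), and the difference becomes, for each `u`, a single sum over lattice
points `z` of a local defect (`trapezoidDefect`).

* If `z` is near no facet, the defect is a second difference of `h`, hence `O(k⁻²)`; there are
  `O(kⁿ)` such points.
* If `z` is near one facet `F` only, with primitive normal `v`, then `z` lies on an integral level
  `J` of `F`, and whether `z`, `z + u` and `z - u` lie in `K` is decided by the signs of `J`,
  `J + s` and `J - s`, where `s = v ⬝ u`. The resulting weights, summed over all levels `J`, give
  exactly `1/2` whenever `s` is not an integer (`sum_trapezoidWeight`), that is, for almost all `u`.
  Each level can be translated onto `F` by a lattice vector, since `v` is primitive. Subtracting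
  half of the lattice sum over `F` therefore leaves a defect of `O(k⁻¹)` at these `O(kⁿ⁻¹)` points.
* Only `O(kⁿ⁻²)` points are near two facets, and the defect is bounded.

The same counting (`IsFacetSystem.exists_abs_sum_le`) shows that the lattice sum over `F` is
`kⁿ⁻¹ ∫_F h dσ + O(kⁿ⁻²)`: the facet measure is the image of Lebesgue measure on a slab of unit
width, which can be replaced by a slab of width `1/k` (`setIntegral_slab`); a displacement `u` moves
exactly one level of the lattice into the thin slab, so `∫_F h dσ` is again an average of lattice
sums over levels close to `F`.

The argument uses that `K` is the intersection of its facet half-spaces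
(`exists_facet_of_notMem`), that there are finitely many facets (`finite_facetNormals`), and that
the bounding hyperplanes of two facets are transversal or parallel at a positive distance
(`facets_transversal_or_opposite`).
-/

namespace LatticeSum

variable {n : ℕ}

/-! ### Facets of an integer polytope -/

/-- The linear functional `x ↦ v ⬝ x` on `ℝⁿ` given by an integer vector `v`. -/
noncomputable def pairing (v : Fin n → ℤ) : (Fin n → ℝ) →ₗ[ℝ] ℝ where
  toFun x := toReal v ⬝ᵥ x
  map_add' := dotProduct_add _
  map_smul' r x := by simp [dotProduct_smul]

theorem pairing_apply (v : Fin n → ℤ) (x : Fin n → ℝ) : pairing v x = toReal v ⬝ᵥ x := rfl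

theorem toReal_dotProduct_toReal (v z : Fin n → ℤ) :
    toReal v ⬝ᵥ toReal z = ((v ⬝ᵥ z : ℤ) : ℝ) := by
  simp [toReal, dotProduct]

theorem pairing_toReal (v z : Fin n → ℤ) : pairing v (toReal z) = ((v ⬝ᵥ z : ℤ) : ℝ) :=
  toReal_dotProduct_toReal v z

theorem pairing_neg (v : Fin n → ℤ) (x : Fin n → ℝ) : pairing (-v) x = -pairing v x := by
  simp [pairing_apply, toReal, dotProduct]

theorem continuous_pairing (v : Fin n → ℤ) : Continuous (pairing v) :=
  (pairing v).continuous_of_finiteDimensional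

theorem ne_zero_of_gcd_eq_one {v : Fin n → ℤ} (hv : Finset.univ.gcd v = 1) : v ≠ 0 := by
  rintro rfl
  have : Finset.univ.gcd (0 : Fin n → ℤ) = 0 := Finset.gcd_eq_zero_iff.2 fun _ _ => rfl
  omega

theorem pairing_ne_zero {v : Fin n → ℤ} (hv : v ≠ 0) : pairing v ≠ 0 := by
  intro h
  apply hv
  ext i
  have := LinearMap.congr_fun h (Pi.single i 1)
  simpa [pairing_apply, toReal] using this

theorem one_le_pairing_self {v : Fin n → ℤ} (hv : v ≠ 0) : (1 : ℝ) ≤ pairing v (toReal v) := by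
  rw [pairing_toReal]
  have : 0 < v ⬝ᵥ v := lt_of_le_of_ne (Finset.sum_nonneg fun i _ => mul_self_nonneg _)
    (Ne.symm (by rwa [Ne, dotProduct_self_eq_zero]))
  exact_mod_cast this

theorem exists_dotProduct_eq_one {v : Fin n → ℤ} (hv : Finset.univ.gcd v = 1) :
    ∃ e : Fin n → ℤ, v ⬝ᵥ e = 1 := by
  obtain ⟨g, hg⟩ := Finset.gcd_eq_sum_mul Finset.univ v
  exact ⟨g, by rw [← hv, hg, dotProduct]⟩

theorem gcd_neg_eq_one {v : Fin n → ℤ} (hv : Finset.univ.gcd v = 1) :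
    Finset.univ.gcd (-v) = 1 := by
  have := Finset.gcd_mul_left (s := Finset.univ) (f := v) (a := -1)
  have h2 : (fun x => -1 * v x) = -v := by ext; simp
  rw [h2, hv, mul_one, Int.normalize_of_nonpos (by norm_num)] at this
  simpa using this

/-- A primitive integer vector is determined up to sign by the line that it spans; collinearity is
expressed by the vanishing of all `2 × 2` minors. -/
theorem primitive_eq_or_eq_neg {v w : Fin n → ℤ} (hv : Finset.univ.gcd v = 1)
    (hw : Finset.univ.gcd w = 1) (h : ∀ a b, v a * w b = v b * w a) : w = v ∨ w = -v := by
  obtain ⟨e, he⟩ := exists_dotProduct_eq_one hv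
  obtain ⟨f, hf⟩ := exists_dotProduct_eq_one hw
  have h1 : ∀ b, w b = v b * (w ⬝ᵥ e) := fun b => by
    calc w b = (v ⬝ᵥ e) * w b := by rw [he, one_mul]
      _ = _ := by
        simp only [dotProduct, Finset.sum_mul, Finset.mul_sum]
        exact Finset.sum_congr rfl fun a _ => by linear_combination e a * h a b
  have h2 : 1 = (v ⬝ᵥ f) * (w ⬝ᵥ e) := by
    rw [← hf, dotProduct, dotProduct, Finset.sum_mul]
    exact Finset.sum_congr rfl fun a _ => by rw [h1 a]; ring
  rcases Int.eq_one_or_neg_one_of_mul_eq_one' h2.symm with h3 | h3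
  · left; ext b; rw [h1 b, h3.2, mul_one]
  · right; ext b; rw [h1 b, h3.2]; simp

/-- The minimum of an integer functional over an integer polytope is attained at a vertex, so it is
an integer. -/
theorem exists_isLeast_pairing {V : Finset (Fin n → ℤ)} {K : Set (Fin n → ℝ)}
    (hK : K = convexHull ℝ (toReal '' (V : Set (Fin n → ℤ)))) (hne : K.Nonempty)
    (v : Fin n → ℤ) :
    ∃ c : ℤ, sInf ((fun y => toReal v ⬝ᵥ y) '' K) = c ∧ ∀ x ∈ K, (c : ℝ) ≤ pairing v x := by
  have hV : V.Nonempty := by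
    by_contra h
    rw [Finset.not_nonempty_iff_eq_empty] at h
    subst h
    simp [hK] at hne
  obtain ⟨a, ha, hmin⟩ := V.exists_min_image (fun z => v ⬝ᵥ z) hV
  have hle : ∀ x ∈ K, ((v ⬝ᵥ a : ℤ) : ℝ) ≤ pairing v x := by
    have hc : Convex ℝ {x | ((v ⬝ᵥ a : ℤ) : ℝ) ≤ pairing v x} :=
      convex_halfSpace_ge (pairing v).isLinear _
    rw [hK]
    refine fun x hx => convexHull_min ?_ hc hx
    rintro _ ⟨z, hz, rfl⟩
    simp only [Set.mem_ofPred_eq, pairing_toReal]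
    exact_mod_cast hmin z hz
  refine ⟨v ⬝ᵥ a, IsLeast.csInf_eq ⟨⟨toReal a, ?_, toReal_dotProduct_toReal v a⟩, ?_⟩, hle⟩
  · rw [hK]; exact subset_convexHull ℝ _ ⟨a, ha, rfl⟩
  · rintro _ ⟨y, hy, rfl⟩; exact hle y hy

theorem lt_pairing_of_mem_interior {K : Set (Fin n → ℝ)} {v : Fin n → ℤ} (hv : v ≠ 0) {c : ℝ}
    (hc : ∀ x ∈ K, c ≤ pairing v x) {x : Fin n → ℝ} (hx : x ∈ interior K) :
    c < pairing v x := by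
  have hpos : 0 < pairing v (toReal v) := one_pos.trans_le (one_le_pairing_self hv)
  have hcont : Continuous fun t : ℝ => x - t • toReal v := by fun_prop
  have h1 : ∀ᶠ t in nhds (0 : ℝ), x - t • toReal v ∈ interior K :=
    hcont.continuousAt.eventually (by simpa using isOpen_interior.mem_nhds hx)
  have h2 : ∀ᶠ t in nhdsWithin (0 : ℝ) (Set.Ioi 0), x - t • toReal v ∈ interior K :=
    nhdsWithin_le_nhds h1
  obtain ⟨t, ht, ht0⟩ := (h2.and self_mem_nhdsWithin).exists
  have h3 := hc _ (interior_subset ht)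
  rw [map_sub, map_smul, smul_eq_mul] at h3
  have := mul_pos (Set.mem_Ioi.1 ht0) hpos
  linarith

theorem vectorSpan_le_ker {φ : (Fin n → ℝ) →ₗ[ℝ] ℝ} {s : Set (Fin n → ℝ)} {c : ℝ}
    (h : ∀ x ∈ s, φ x = c) : vectorSpan ℝ s ≤ LinearMap.ker φ := by
  rw [vectorSpan_def, Submodule.span_le]
  rintro _ ⟨x, hx, y, hy, rfl⟩
  simp [h x hx, h y hy]

theorem pairing_eq_of_mem_face {K : Set (Fin n → ℝ)} {v : Fin n → ℤ} {x : Fin n → ℝ}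
    (hx : x ∈ face K v) : pairing v x = sInf ((fun y => toReal v ⬝ᵥ y) '' K) :=
  sub_eq_zero.1 hx.2

/-- The dimension condition on a facet makes it span the whole hyperplane orthogonal to its
normal. -/
theorem vectorSpan_face {K : Set (Fin n → ℝ)} {v : Fin n → ℤ}
    (hv : IsPrimitiveFacetNormal K v) : vectorSpan ℝ (face K v) = LinearMap.ker (pairing v) := by
  apply Submodule.eq_of_le_of_finrank_eq
  · exact vectorSpan_le_ker fun x hx => pairing_eq_of_mem_face hx
  · have h1 := Module.Dual.finrank_ker_add_one_of_ne_zero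
      (pairing_ne_zero (ne_zero_of_gcd_eq_one hv.1))
    have h2 := hv.2.2
    rw [Module.finrank_fin_fun] at h1
    omega

/-- If a functional attains its minimum at a convex combination with positive weights, then it is
minimal at each of the combined points. -/
theorem eq_of_pos_combination {ι : Type*} [Fintype ι] {φ : (Fin n → ℝ) →ₗ[ℝ] ℝ}
    {z : ι → Fin n → ℝ} {w : ι → ℝ} (hw : ∀ i, 0 < w i) (hsum : ∑ i, w i = 1) {c : ℝ}
    (hc : φ (∑ i, w i • z i) = c) (hle : ∀ i, c ≤ φ (z i)) (i : ι) : φ (z i) = c := by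
  have h0 : ∑ i, w i * (φ (z i) - c) = 0 := by
    simp_rw [mul_sub, Finset.sum_sub_distrib, ← Finset.sum_mul, hsum, ← hc]
    simp
  have h1 := (Finset.sum_eq_zero_iff_of_nonneg fun i _ =>
    mul_nonneg (hw i).le (sub_nonneg.2 (hle i))).1 h0 i (Finset.mem_univ i)
  rcases mul_eq_zero.1 h1 with h | h
  · exact absurd h (hw i).ne'
  · linarith

theorem minors_eq_of_ker_eq {v w : Fin n → ℤ}
    (h : LinearMap.ker (pairing v) = LinearMap.ker (pairing w)) (a b : Fin n) :
    v a * w b = v b * w a := by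
  have h1 : toReal (Pi.single b (v a) - Pi.single a (v b)) ∈ LinearMap.ker (pairing v) := by
    rw [LinearMap.mem_ker, pairing_toReal, dotProduct_sub, dotProduct_single, dotProduct_single]
    push_cast; ring
  rw [h, LinearMap.mem_ker, pairing_toReal, dotProduct_sub, dotProduct_single,
    dotProduct_single, Int.cast_eq_zero] at h1
  linarith

/-- Two distinct facets either have linearly independent normals, or are parallel and opposite, in
which case the distance between them is positive. -/
theorem facets_transversal_or_opposite {V : Finset (Fin n → ℤ)} {K : Set (Fin n → ℝ)}
    (hK : K = convexHull ℝ (toReal '' (V : Set (Fin n → ℤ)))) (hne : (interior K).Nonempty)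
    {v w : Fin n → ℤ} (hv : Finset.univ.gcd v = 1) (hw : Finset.univ.gcd w = 1)
    (hvw : v ≠ w) :
    (∃ a b, v a * w b ≠ v b * w a) ∨ (w = -v ∧
      sInf ((fun y => toReal v ⬝ᵥ y) '' K) + sInf ((fun y => toReal w ⬝ᵥ y) '' K) < 0) := by
  by_cases h : ∃ a b, v a * w b ≠ v b * w a
  · exact Or.inl h
  right
  push Not at h
  rcases primitive_eq_or_eq_neg hv hw h with h1 | h1
  · exact absurd h1.symm hvw
  refine ⟨h1, ?_⟩
  obtain ⟨x, hx⟩ := hne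
  obtain ⟨c, hc, hc'⟩ := exists_isLeast_pairing hK ⟨x, interior_subset hx⟩ v
  obtain ⟨d, hd, hd'⟩ := exists_isLeast_pairing hK ⟨x, interior_subset hx⟩ w
  rw [hc, hd]
  have h2 := lt_pairing_of_mem_interior (ne_zero_of_gcd_eq_one hv) hc' hx
  have h3 := hd' x (interior_subset hx)
  rw [h1, pairing_neg] at h3
  linarith

/-- There are finitely many facets, because each is determined by the vertices on it. -/
theorem finite_facetNormals {V : Finset (Fin n → ℤ)} {K : Set (Fin n → ℝ)}
    (hK : K = convexHull ℝ (toReal '' (V : Set (Fin n → ℤ)))) (hne : (interior K).Nonempty) :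
    {v | IsPrimitiveFacetNormal K v}.Finite := by
  classical
  refine Set.Finite.of_injOn (f := fun v => V.filter fun a => toReal a ∈ face K v)
    (t := (V.powerset : Set (Finset (Fin n → ℤ)))) ?_ ?_ (Finset.finite_toSet _)
  · exact fun v _ => Finset.mem_coe.2 (Finset.mem_powerset.2 (Finset.filter_subset _ _))
  intro v hv w hw hvw
  have key : ∀ {v w : Fin n → ℤ}, (V.filter fun a => toReal a ∈ face K v) =
      (V.filter fun a => toReal a ∈ face K w) → face K v ⊆ face K w := by
    intro v w hvw x hx
    obtain ⟨c, hc, hc'⟩ := exists_isLeast_pairing hK (hne.mono interior_subset) v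
    have hxK := hx.1
    rw [hK] at hxK
    obtain ⟨ι, _, z, t, hz, -, ht, hsum, hx'⟩ := eq_pos_convex_span_of_mem_convexHull hxK
    have hzK : ∀ i, z i ∈ K := fun i => hK ▸ subset_convexHull ℝ _ (hz ⟨i, rfl⟩)
    have h1 : ∀ i, pairing v (z i) = c := fun i => eq_of_pos_combination ht hsum
      (by rw [hx', pairing_eq_of_mem_face hx, hc]) (fun i => hc' _ (hzK i)) i
    have h2 : ∀ i, z i ∈ face K w := fun i => by
      obtain ⟨a, ha, hai⟩ := hz ⟨i, rfl⟩
      have : a ∈ V.filter fun a => toReal a ∈ face K v := by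
        rw [Finset.mem_filter]
        refine ⟨ha, ?_⟩
        rw [hai]
        refine ⟨hzK i, sub_eq_zero.2 ?_⟩
        rw [hc]; exact h1 i
      rw [hvw, Finset.mem_filter, hai] at this
      exact this.2
    refine ⟨hx.1, sub_eq_zero.2 ?_⟩
    rw [← pairing_apply, ← hx', map_sum]
    simp_rw [map_smul, pairing_eq_of_mem_face (h2 _), smul_eq_mul, ← Finset.sum_mul, hsum,
      one_mul]
  have hface : face K v = face K w := (key hvw).antisymm (key hvw.symm)
  by_contra hne'
  have hker : LinearMap.ker (pairing v) = LinearMap.ker (pairing w) := by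
    rw [← vectorSpan_face hv, ← vectorSpan_face hw, hface]
  rcases facets_transversal_or_opposite hK hne hv.1 hw.1 hne' with ⟨a, b, hab⟩ | ⟨h1, h2⟩
  · exact hab (minors_eq_of_ker_eq hker a b)
  · obtain ⟨x, hx⟩ := hv.2.1
    have h3 := pairing_eq_of_mem_face hx
    rw [hface] at hx
    have h4 := pairing_eq_of_mem_face hx
    rw [← h3, ← h4, h1, pairing_neg] at h2
    linarith

/-! ### The facet half-spaces -/

/-- The affine spans of fewer than `n` vertices together with `x` have measure zero, so an interior
point can be chosen off all of them. -/
theorem exists_generic_interior {K : Set (Fin n → ℝ)} (hne : (interior K).Nonempty)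
    (V : Finset (Fin n → ℝ)) (x : Fin n → ℝ) :
    ∃ z ∈ interior K, ∀ W ⊆ V, W.card < n →
      z ∉ affineSpan ℝ (insert x (W : Set (Fin n → ℝ))) := by
  classical
  have hfin : {W : Finset (Fin n → ℝ) | W ⊆ V ∧ W.card < n}.Finite :=
    V.powerset.finite_toSet.subset fun W hW => Finset.mem_coe.2 (Finset.mem_powerset.2 hW.1)
  have h0 : volume (⋃ W ∈ {W : Finset (Fin n → ℝ) | W ⊆ V ∧ W.card < n},
      (affineSpan ℝ (insert x (W : Set (Fin n → ℝ))) : Set (Fin n → ℝ))) = 0 := by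
    refine (measure_biUnion_null_iff hfin.countable).2 ?_
    rintro W ⟨-, hcard⟩
    apply Measure.addHaar_affineSubspace
    intro htop
    have h1 : Module.finrank ℝ (vectorSpan ℝ (insert x (W : Set (Fin n → ℝ)))) = n := by
      rw [← direction_affineSpan, htop, AffineSubspace.direction_top, finrank_top,
        Module.finrank_fin_fun]
    have hpos : 0 < (insert x W).card := Finset.card_pos.2 (Finset.insert_nonempty _ _)
    have h2 := finrank_vectorSpan_image_finset_le ℝ (id : (Fin n → ℝ) → Fin n → ℝ)
      (insert x W) (n := (insert x W).card - 1) (by omega)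
    rw [Finset.image_id, Finset.coe_insert, h1] at h2
    have h3 := Finset.card_insert_le x W
    omega
  have h1 : 0 < volume (interior K) := isOpen_interior.measure_pos _ hne
  have h2 : ¬ interior K ⊆ ⋃ W ∈ {W : Finset (Fin n → ℝ) | W ⊆ V ∧ W.card < n},
      (affineSpan ℝ (insert x (W : Set (Fin n → ℝ))) : Set (Fin n → ℝ)) := fun h =>
    h1.ne' (measure_mono_null h h0)
  obtain ⟨z, hz, hz'⟩ := Set.not_subset.1 h2
  refine ⟨z, hz, fun W hW hWc hmem => hz' ?_⟩
  simp only [Set.mem_iUnion]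
  exact ⟨W, ⟨hW, hWc⟩, hmem⟩

/-- The last point of a compact set on a segment that leaves it. -/
theorem exists_exit_point {K : Set (Fin n → ℝ)} (hK : IsCompact K) {x z : Fin n → ℝ}
    (hz : z ∈ interior K) (hx : x ∉ K) :
    ∃ t : ℝ, 0 < t ∧ t < 1 ∧ AffineMap.lineMap z x t ∈ K ∧
      AffineMap.lineMap z x t ∉ interior K := by
  have hcont : Continuous fun t : ℝ => (AffineMap.lineMap z x t : Fin n → ℝ) :=
    AffineMap.lineMap_continuous
  set T : Set ℝ := Set.Icc 0 1 ∩ (fun t : ℝ => (AffineMap.lineMap z x t : Fin n → ℝ)) ⁻¹' K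
  have hT : IsCompact T := isCompact_Icc.inter_right (hK.isClosed.preimage hcont)
  have hTne : T.Nonempty := ⟨0, by simp, by simpa using interior_subset hz⟩
  obtain ⟨t, ⟨⟨ht0, ht1⟩, htK⟩, htmax⟩ := hT.exists_isGreatest hTne
  have ht1' : t < 1 := by
    refine lt_of_le_of_ne ht1 fun h => hx ?_
    simpa [h] using htK
  have hnot : AffineMap.lineMap z x t ∉ interior K := by
    intro hmem
    have h1 : ∀ᶠ s in nhdsWithin t (Set.Ioi t), AffineMap.lineMap z x s ∈ interior K :=
      nhdsWithin_le_nhds (hcont.continuousAt.eventually (isOpen_interior.mem_nhds hmem))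
    have h2 : ∀ᶠ s in nhdsWithin t (Set.Ioi t), s < 1 :=
      nhdsWithin_le_nhds (eventually_lt_nhds ht1')
    obtain ⟨s, ⟨hs, hs1⟩, hst⟩ := ((h1.and h2).and self_mem_nhdsWithin).exists
    have hst : t < s := hst
    have := htmax (a := s) ⟨⟨by linarith, hs1.le⟩, (interior_subset hs : _ ∈ K)⟩
    linarith
  refine ⟨t, lt_of_le_of_ne ht0 fun h => hnot ?_, ht1', htK, hnot⟩
  rwa [← h, AffineMap.lineMap_apply_zero]

/-- `n` affinely independent integer points span a hyperplane with a primitive integer normal. -/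
theorem exists_primitive_normal {ι : Type*} [Fintype ι] [Nonempty ι]
    (hcard : Fintype.card ι = n) (z : ι → Fin n → ℤ) :
    ∃ v : Fin n → ℤ, Finset.univ.gcd v = 1 ∧ ∀ i j, v ⬝ᵥ z i = v ⬝ᵥ z j := by
  classical
  let i₀ : ι := Classical.arbitrary ι
  let e : Fin n ≃ ι := (Fintype.equivFinOfCardEq hcard).symm
  let M : Matrix (Fin n) (Fin n) ℤ := fun a => z (e a) - z i₀
  have hdet : M.det = 0 := Matrix.det_eq_zero_of_row_eq_zero (e.symm i₀) fun j => by simp [M]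
  obtain ⟨u, hu, hMu⟩ := Matrix.exists_mulVec_eq_zero_iff.2 hdet
  have hn : (Finset.univ : Finset (Fin n)).Nonempty := ⟨e.symm i₀, Finset.mem_univ _⟩
  obtain ⟨v, hv, hv1⟩ := Finset.extract_gcd u hn
  have hg : Finset.univ.gcd u ≠ 0 := by
    intro h
    exact hu (funext fun i => Finset.gcd_eq_zero_iff.1 h i (Finset.mem_univ i))
  have huv : u = Finset.univ.gcd u • v := by
    ext i; simpa using hv i (Finset.mem_univ i)
  have key : ∀ i, v ⬝ᵥ z i = v ⬝ᵥ z i₀ := by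
    intro i
    have h1 : (z i - z i₀) ⬝ᵥ u = 0 := by
      have hrow : M (e.symm i) = z i - z i₀ := by simp [M]
      rw [← hrow]
      exact congrFun hMu (e.symm i)
    rw [huv, dotProduct_smul, smul_eq_zero, or_iff_right hg, sub_dotProduct, sub_eq_zero] at h1
    rw [dotProduct_comm, h1, dotProduct_comm]
  exact ⟨v, hv1, fun i j => (key i).trans (key j).symm⟩

/-- A full-dimensional integer polytope is the intersection of its facet half-spaces. A point `x`
outside is joined to an interior point in general position; the segment leaves the polytope in a
point lying in no face of dimension less than `n - 1`, hence through a facet. -/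
theorem exists_facet_of_notMem {V : Finset (Fin n → ℤ)} {K : Set (Fin n → ℝ)}
    (hK : K = convexHull ℝ (toReal '' (V : Set (Fin n → ℤ)))) (hne : (interior K).Nonempty)
    {x : Fin n → ℝ} (hx : x ∉ K) : ∃ v, IsPrimitiveFacetNormal K v ∧ facetFun K v x < 0 := by
  classical
  have hKc : IsCompact K := hK ▸ (V.finite_toSet.image _).isCompact_convexHull ℝ
  have hKconv : Convex ℝ K := hK ▸ convex_convexHull ℝ _
  obtain ⟨z, hz, hgen⟩ := exists_generic_interior hne (V.image toReal) x
  obtain ⟨t, ht0, ht1, hyK, hyint⟩ := exists_exit_point hKc hz hx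
  set y : Fin n → ℝ := AffineMap.lineMap z x t with hy
  obtain ⟨f, hf⟩ := geometric_hahn_banach_open_point hKconv.interior isOpen_interior hyint
  have hfK : ∀ a ∈ K, f a ≤ f y := by
    have h1 : K ⊆ closure (interior K) := by
      rw [hKconv.closure_interior_eq_closure_of_nonempty_interior hne]
      exact subset_closure
    exact fun a ha => closure_minimal (fun b hb => (hf b hb).le)
      (isClosed_le f.continuous continuous_const) (h1 ha)
  have hyx : f y = f z + t * (f x - f z) := by
    rw [hy, AffineMap.lineMap_apply_module', map_add, map_smul, map_sub, smul_eq_mul]; ring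
  have hfz := hf z hz
  have hfx : f y < f x := by nlinarith
  set φ : (Fin n → ℝ) →ₗ[ℝ] ℝ := (f : (Fin n → ℝ) →ₗ[ℝ] ℝ) with hφ
  have hφ0 : φ ≠ 0 := by
    intro h
    have h1 : ∀ a, f a = 0 := fun a => LinearMap.congr_fun h a
    rw [h1, h1] at hfz
    exact lt_irrefl _ hfz
  have hker := Module.Dual.finrank_ker_add_one_of_ne_zero hφ0
  rw [Module.finrank_fin_fun] at hker
  have hy' := hyK
  rw [hK] at hy'
  obtain ⟨ι, _, p, w, hp, hind, hw, hsum, hpy⟩ := eq_pos_convex_span_of_mem_convexHull hy'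
  have hpK : ∀ i, p i ∈ K := fun i => hK ▸ subset_convexHull ℝ _ (hp ⟨i, rfl⟩)
  have hpf : ∀ i, φ (p i) = φ y := fun i => by
    have := eq_of_pos_combination (φ := -φ) hw hsum (c := -φ y) (by rw [hpy]; rfl)
      (fun i => by simpa [hφ] using hfK _ (hpK i)) i
    simpa using this
  have hι : Nonempty ι := by
    by_contra h
    rw [not_nonempty_iff] at h
    simp at hsum
  have hcard_ge : n ≤ Fintype.card ι := by
    by_contra hlt
    push Not at hlt
    apply hgen (Finset.univ.image p) ?_ (lt_of_le_of_lt Finset.card_image_le hlt)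
    · have hymem : y ∈ affineSpan ℝ (insert x ((Finset.univ.image p : Finset _) :
          Set (Fin n → ℝ))) := by
        have h1 : y ∈ convexHull ℝ (Set.range p) := by
          rw [← hpy]
          exact (convex_convexHull ℝ _).sum_mem (fun i _ => (hw i).le) hsum
            fun i _ => subset_convexHull ℝ _ ⟨i, rfl⟩
        refine affineSpan_mono ℝ ?_ (convexHull_subset_affineSpan _ h1)
        intro a ha
        simpa using Or.inr ha
      have hxmem : x ∈ affineSpan ℝ (insert x ((Finset.univ.image p : Finset _) :
          Set (Fin n → ℝ))) := subset_affineSpan ℝ _ (Set.mem_insert _ _)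
      have := AffineMap.lineMap_mem (1 / (1 - t)) hxmem hymem
      convert this using 1
      have h1t : (1 - t) ≠ 0 := by linarith
      rw [hy, AffineMap.lineMap_apply_module', AffineMap.lineMap_apply_module']
      have h2 : t • (x - z) + z - x = (1 - t) • (z - x) := by module
      rw [h2, smul_smul, one_div, inv_mul_cancel₀ h1t]
      module
    · intro a ha
      obtain ⟨i, -, rfl⟩ := Finset.mem_image.1 ha
      obtain ⟨b, hb, hb'⟩ := hp ⟨i, rfl⟩
      exact Finset.mem_image.2 ⟨b, hb, hb'⟩
  have hcpos : 0 < Fintype.card ι := Fintype.card_pos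
  have hspan := hind.finrank_vectorSpan (n := Fintype.card ι - 1) (by omega)
  have hspan_le : vectorSpan ℝ (Set.range p) ≤ LinearMap.ker φ :=
    vectorSpan_le_ker (c := φ y) (by rintro _ ⟨i, rfl⟩; exact hpf i)
  have hcard : Fintype.card ι = n := by
    have := Submodule.finrank_mono hspan_le
    omega
  have hspan_eq : vectorSpan ℝ (Set.range p) = LinearMap.ker φ :=
    Submodule.eq_of_le_of_finrank_eq hspan_le (by omega)
  have hp' : ∀ i, ∃ a : Fin n → ℤ, toReal a = p i := fun i => by
    obtain ⟨b, -, hb'⟩ := hp ⟨i, rfl⟩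
    exact ⟨b, hb'⟩
  choose q hq using hp'
  obtain ⟨v, hv, hvq⟩ := exists_primitive_normal hcard q
  have hle : LinearMap.ker φ ≤ LinearMap.ker (pairing v) := by
    rw [← hspan_eq]
    let i₀ : ι := Classical.arbitrary ι
    refine vectorSpan_le_ker (c := pairing v (p i₀)) ?_
    rintro _ ⟨i, rfl⟩
    rw [← hq, ← hq, pairing_toReal, pairing_toReal, hvq i i₀]
  have hle' : LinearMap.ker (pairing v) = LinearMap.ker φ := by
    refine (Submodule.eq_of_le_of_finrank_eq hle ?_).symm
    have := Module.Dual.finrank_ker_add_one_of_ne_zero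
      (pairing_ne_zero (ne_zero_of_gcd_eq_one hv))
    rw [Module.finrank_fin_fun] at this
    omega
  obtain ⟨r, hr⟩ : ∃ r : ℝ, r • pairing v = φ := by
    have h1 : φ ∈ Submodule.span ℝ (Set.range fun _ : Unit => pairing v) :=
      mem_span_of_iInf_ker_le_ker (by simpa using hle'.le)
    rw [Set.range_const] at h1
    exact Submodule.mem_span_singleton.1 h1
  -- The sign of the normal is chosen so that it points inwards.
  obtain ⟨v', hv', r', hr', hvr⟩ : ∃ v' : Fin n → ℤ, Finset.univ.gcd v' = 1 ∧ ∃ r' : ℝ, 0 < r' ∧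
      ∀ a, f a = -r' * pairing v' a := by
    have hr0 : r ≠ 0 := by rintro rfl; exact hφ0 (by rw [← hr, zero_smul])
    have h1 : ∀ a, f a = r * pairing v a := fun a => (LinearMap.congr_fun hr a).symm
    rcases lt_or_gt_of_ne hr0 with h | h
    · exact ⟨v, hv, -r, by linarith, fun a => by rw [h1]; ring⟩
    · exact ⟨-v, gcd_neg_eq_one hv, r, h, fun a => by rw [h1, pairing_neg]; ring⟩
  have hmin : ∀ a ∈ K, pairing v' y ≤ pairing v' a := fun a ha => by
    have := hfK a ha
    rw [hvr, hvr] at this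
    nlinarith
  have hsInf : sInf ((fun y => toReal v' ⬝ᵥ y) '' K) = pairing v' y :=
    IsLeast.csInf_eq ⟨⟨y, hyK, rfl⟩, by rintro _ ⟨a, ha, rfl⟩; exact hmin a ha⟩
  have hpface : Set.range p ⊆ face K v' := by
    rintro _ ⟨i, rfl⟩
    refine ⟨hpK i, sub_eq_zero.2 ?_⟩
    have h1 : f (p i) = f y := hpf i
    rw [hvr, hvr] at h1
    rw [hsInf, ← pairing_apply]
    exact mul_left_cancel₀ (by linarith : -r' ≠ 0) h1
  refine ⟨v', ⟨hv', ⟨y, hyK, sub_eq_zero.2 hsInf.symm⟩, ?_⟩, ?_⟩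
  · have h1 := Submodule.finrank_mono (vectorSpan_mono ℝ hpface)
    have h2 : vectorSpan ℝ (face K v') ≤ LinearMap.ker (pairing v') :=
      vectorSpan_le_ker fun a ha => pairing_eq_of_mem_face ha
    have h3 := Submodule.finrank_mono h2
    have h4 := Module.Dual.finrank_ker_add_one_of_ne_zero
      (pairing_ne_zero (ne_zero_of_gcd_eq_one hv'))
    rw [Module.finrank_fin_fun] at h4
    omega
  · rw [facetFun, hsInf, ← pairing_apply]
    rw [hvr, hvr] at hfx
    nlinarith

/-! ### Counting lattice points near facets -/

/-- The points of `ℤⁿ` all of whose coordinates have absolute value at most `m`. -/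
noncomputable def latticeBox (n m : ℕ) : Finset (Fin n → ℤ) :=
  Fintype.piFinset fun _ => Finset.Icc (-(m : ℤ)) m

theorem mem_latticeBox {m : ℕ} {z : Fin n → ℤ} : z ∈ latticeBox n m ↔ ∀ i, |z i| ≤ m := by
  simp [latticeBox, abs_le]

theorem card_latticeBox (m : ℕ) : (latticeBox n m).card = (2 * m + 1) ^ n := by
  rw [latticeBox, Fintype.card_piFinset]
  simp only [Int.card_Icc, Finset.prod_const, Finset.card_univ, Fintype.card_fin]
  congr 1
  omega

theorem card_Icc_sub_add (t : ℤ) (N : ℕ) : (Finset.Icc (t - N) (t + N)).card = 2 * N + 1 := by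
  rw [Int.card_Icc]; omega

/-- A slab of bounded width contains `O(m ^ (n - 1))` points of the box: replacing one coordinate by
an integer functional that involves it is injective on `ℤⁿ`. -/
theorem card_slab_le {v : Fin n → ℤ} (hv : v ≠ 0) (m N : ℕ) (t : ℤ) :
    ((latticeBox n m).filter fun z => |v ⬝ᵥ z - t| ≤ N).card * (2 * m + 1) ≤
      (2 * N + 1) * (2 * m + 1) ^ n := by
  obtain ⟨a, ha⟩ := Function.ne_iff.1 hv
  rw [Pi.zero_apply] at ha
  let T : Fin n → Finset ℤ :=
    Function.update (fun _ => Finset.Icc (-(m : ℤ)) m) a (Finset.Icc (t - N) (t + N))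
  have hle : ((latticeBox n m).filter fun z => |v ⬝ᵥ z - t| ≤ N).card ≤
      (Fintype.piFinset T).card := by
    apply Finset.card_le_card_of_injOn fun z => Function.update z a (v ⬝ᵥ z)
    · intro z hz
      obtain ⟨hz, hz'⟩ := Finset.mem_filter.1 hz
      rw [Finset.mem_coe, Fintype.mem_piFinset]
      intro i
      by_cases hi : i = a
      · subst hi
        simp only [T, Function.update_self, Finset.mem_Icc]
        rw [abs_le] at hz'
        omega
      · simp only [T, Function.update_of_ne hi, Finset.mem_Icc]
        exact abs_le.1 (mem_latticeBox.1 hz i)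
    · intro z _ z' _ h
      have h0 : ∀ i, i ≠ a → z i = z' i := fun i hi => by
        simpa [Function.update_of_ne hi] using congrFun h i
      have h1 : v ⬝ᵥ z = v ⬝ᵥ z' := by simpa using congrFun h a
      have h2 : v ⬝ᵥ (z - z') = v a * (z - z') a := Finset.sum_eq_single a
        (fun i _ hi => by rw [Pi.sub_apply, h0 i hi, sub_self, mul_zero]) (by simp)
      rw [dotProduct_sub, h1, sub_self, eq_comm, mul_eq_zero, or_iff_right ha] at h2
      ext i
      by_cases hi : i = a
      · rw [hi]; exact sub_eq_zero.1 h2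
      · exact h0 i hi
  have hcard : (Fintype.piFinset T).card * (2 * m + 1) = (2 * N + 1) * (2 * m + 1) ^ n := by
    have h1 : ∀ i, (T i).card = Function.update (fun _ => 2 * m + 1) a (2 * N + 1) i := by
      intro i
      by_cases hi : i = a
      · subst hi; simp only [T, Function.update_self, card_Icc_sub_add]
      · simp only [T, Function.update_of_ne hi, Int.card_Icc]; omega
    rw [Fintype.card_piFinset, Finset.prod_congr rfl fun i _ => h1 i,
      Finset.prod_update_of_mem (Finset.mem_univ a), Finset.prod_const, mul_assoc, ← pow_succ]
    congr 2
    rw [Finset.card_sdiff_of_subset (by simp)]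
    have := a.pos
    simp only [Finset.card_univ, Fintype.card_fin, Finset.card_singleton]
    omega
  calc _ ≤ _ := Nat.mul_le_mul_right _ hle
    _ = _ := hcard

/-- Two transversal slabs of bounded width have `O(m ^ (n - 2))` points of the box in common:
replacing two coordinates by two integer functionals is injective if their minor in these
coordinates is nonzero. -/
theorem card_slab_inter_slab_le {v w : Fin n → ℤ} {a b : Fin n} (hab : v a * w b ≠ v b * w a)
    (m N : ℕ) (t s : ℤ) :
    ((latticeBox n m).filter fun z => |v ⬝ᵥ z - t| ≤ N ∧ |w ⬝ᵥ z - s| ≤ N).card *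
      (2 * m + 1) ^ 2 ≤ (2 * N + 1) ^ 2 * (2 * m + 1) ^ n := by
  have hne : a ≠ b := by rintro rfl; exact hab rfl
  let T : Fin n → Finset ℤ :=
    Function.update (Function.update (fun _ => Finset.Icc (-(m : ℤ)) m) b
      (Finset.Icc (s - N) (s + N))) a (Finset.Icc (t - N) (t + N))
  have hle : ((latticeBox n m).filter fun z => |v ⬝ᵥ z - t| ≤ N ∧ |w ⬝ᵥ z - s| ≤ N).card ≤
      (Fintype.piFinset T).card := by
    apply Finset.card_le_card_of_injOn fun z =>
      Function.update (Function.update z b (w ⬝ᵥ z)) a (v ⬝ᵥ z)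
    · intro z hz
      obtain ⟨hz, hz', hz''⟩ := Finset.mem_filter.1 hz
      rw [abs_le] at hz' hz''
      rw [Finset.mem_coe, Fintype.mem_piFinset]
      intro i
      by_cases hi : i = a
      · subst hi
        simp only [T, Function.update_self, Finset.mem_Icc]
        omega
      by_cases hi' : i = b
      · subst hi'
        simp only [T, Function.update_of_ne hi, Function.update_self, Finset.mem_Icc]
        omega
      · simp only [T, Function.update_of_ne hi, Function.update_of_ne hi', Finset.mem_Icc]
        exact abs_le.1 (mem_latticeBox.1 hz i)
    · intro z _ z' _ h
      have h0 : ∀ i, i ≠ a → i ≠ b → z i = z' i := fun i hi hi' => by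
        simpa [Function.update_of_ne hi, Function.update_of_ne hi'] using congrFun h i
      have h1 : v ⬝ᵥ z = v ⬝ᵥ z' := by simpa using congrFun h a
      have h2 : w ⬝ᵥ z = w ⬝ᵥ z' := by
        simpa [Function.update_of_ne hne.symm] using congrFun h b
      have h3 : ∀ u : Fin n → ℤ, u ⬝ᵥ (z - z') = u a * (z - z') a + u b * (z - z') b := fun u =>
        Finset.sum_eq_add a b hne
          (fun i _ hi => by rw [Pi.sub_apply, h0 i hi.1 hi.2, sub_self, mul_zero])
          (by simp) (by simp)
      have h4 := h3 v
      have h5 := h3 w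
      rw [dotProduct_sub, h1, sub_self] at h4
      rw [dotProduct_sub, h2, sub_self] at h5
      have h6 : v a * w b - v b * w a ≠ 0 := sub_ne_zero.2 hab
      have h7 : (z - z') a = 0 := mul_left_cancel₀ h6 (by linear_combination v b * h5 - w b * h4)
      have h8 : (z - z') b = 0 := mul_left_cancel₀ h6 (by linear_combination w a * h4 - v a * h5)
      ext i
      by_cases hi : i = a
      · rw [hi]; exact sub_eq_zero.1 h7
      by_cases hi' : i = b
      · rw [hi']; exact sub_eq_zero.1 h8
      · exact h0 i hi hi'
  have hcard : (Fintype.piFinset T).card * (2 * m + 1) ^ 2 =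
      (2 * N + 1) ^ 2 * (2 * m + 1) ^ n := by
    have h1 : ∀ i, (T i).card = Function.update (Function.update (fun _ => 2 * m + 1) b
        (2 * N + 1)) a (2 * N + 1) i := by
      intro i
      by_cases hi : i = a
      · subst hi; simp only [T, Function.update_self, card_Icc_sub_add]
      by_cases hi' : i = b
      · subst hi'
        simp only [T, Function.update_of_ne hi, Function.update_self, card_Icc_sub_add]
      · simp only [T, Function.update_of_ne hi, Function.update_of_ne hi', Int.card_Icc]; omega
    have hb : b ∈ Finset.univ \ {a} := by simpa using hne.symm
    have hn : 2 ≤ n := by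
      have h2 := Finset.card_le_univ ({a, b} : Finset (Fin n))
      rwa [Finset.card_pair hne, Fintype.card_fin] at h2
    rw [Fintype.card_piFinset, Finset.prod_congr rfl fun i _ => h1 i,
      Finset.prod_update_of_mem (Finset.mem_univ a), Finset.prod_update_of_mem hb,
      Finset.prod_const, sq (2 * N + 1), mul_assoc, mul_assoc, mul_assoc, ← pow_add]
    congr 3
    rw [Finset.card_sdiff_of_subset (by simpa using hne.symm),
      Finset.card_sdiff_of_subset (by simp)]
    simp only [Finset.card_univ, Fintype.card_fin, Finset.card_singleton]
    omega
  calc _ ≤ _ := Nat.mul_le_mul_right _ hle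
    _ = _ := hcard

/-- A description of `K ⊂ ℝⁿ` by finitely many inequalities `c i ≤ v i ⬝ x` with primitive integer
`v i` and integer `c i`, such that no two of the bounding hyperplanes coincide: any two have
linearly independent normals or are opposite and at a positive distance. -/
structure IsFacetSystem {ι : Type*} (K : Set (Fin n → ℝ)) (v : ι → Fin n → ℤ) (c : ι → ℤ) :
    Prop where
  mem_iff : ∀ x, x ∈ K ↔ ∀ i, (c i : ℝ) ≤ pairing (v i) x
  gcd_eq_one : ∀ i, Finset.univ.gcd (v i) = 1
  transversal : ∀ i j, i ≠ j → (∃ a b, v i a * v j b ≠ v i b * v j a) ∨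
    (v j = -v i ∧ c i + c j < 0)

/-- The value at the lattice point `z` of the affine function vanishing on the facet
`v ⬝ x = c` of a polytope scaled by `k`. -/
def level (v : Fin n → ℤ) (c : ℤ) (k : ℕ) (z : Fin n → ℤ) : ℤ := v ⬝ᵥ z - k * c

theorem pow_le_of_two_mul_add_one (R : ℕ) {k : ℕ} (hk : 1 ≤ k) (n : ℕ) :
    ((2 * (R * k : ℕ) + 1 : ℕ) : ℝ) ^ n ≤ (2 * R + 1 : ℝ) ^ n * (k : ℝ) ^ n := by
  rw [← mul_pow]
  have h1 : (1 : ℝ) ≤ k := by exact_mod_cast hk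
  gcongr
  push_cast
  nlinarith

theorem le_two_mul_add_one {R : ℕ} (hR : 1 ≤ R) (k : ℕ) :
    (k : ℝ) ≤ ((2 * (R * k : ℕ) + 1 : ℕ) : ℝ) := by
  have : k ≤ 2 * (R * k) + 1 := by nlinarith
  exact_mod_cast this

theorem exists_card_near_facet_le {v : Fin n → ℤ} (hv : v ≠ 0) (c : ℤ) {R : ℕ} (hR : 1 ≤ R)
    (N : ℕ) : ∃ C : ℝ, ∀ k : ℕ, 1 ≤ k →
      (((latticeBox n (R * k)).filter fun z => |level v c k z| ≤ N).card : ℝ) * k ≤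
        C * (k : ℝ) ^ n := by
  refine ⟨(2 * N + 1) * (2 * R + 1) ^ n, fun k hk => ?_⟩
  have h1 : (((latticeBox n (R * k)).filter fun z => |level v c k z| ≤ N).card : ℝ) *
      ((2 * (R * k : ℕ) + 1 : ℕ) : ℝ) ≤
      (2 * N + 1) * ((2 * (R * k : ℕ) + 1 : ℕ) : ℝ) ^ n := by
    exact_mod_cast card_slab_le hv (R * k) N (k * c)
  calc _ ≤ _ := mul_le_mul_of_nonneg_left (le_two_mul_add_one hR k) (Nat.cast_nonneg _)
    _ ≤ _ := h1
    _ ≤ (2 * N + 1) * ((2 * R + 1 : ℝ) ^ n * (k : ℝ) ^ n) :=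
      mul_le_mul_of_nonneg_left (pow_le_of_two_mul_add_one R hk n) (by positivity)
    _ = _ := by ring

theorem IsFacetSystem.exists_card_near_two_facets_le {ι : Type*} {K : Set (Fin n → ℝ)}
    {v : ι → Fin n → ℤ} {c : ι → ℤ} (hF : IsFacetSystem K v c) {i j : ι} (hij : i ≠ j) {R : ℕ}
    (hR : 1 ≤ R) (N : ℕ) : ∃ C : ℝ, ∀ᶠ k : ℕ in atTop,
      (((latticeBox n (R * k)).filter fun z =>
        |level (v i) (c i) k z| ≤ N ∧ |level (v j) (c j) k z| ≤ N).card : ℝ) * (k : ℝ) ^ 2 ≤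
        C * (k : ℝ) ^ n := by
  rcases hF.transversal i j hij with ⟨a, b, hab⟩ | ⟨hv, hc⟩
  · refine ⟨(2 * N + 1) ^ 2 * (2 * R + 1) ^ n, ?_⟩
    filter_upwards [eventually_ge_atTop 1] with k hk
    have h1 : (((latticeBox n (R * k)).filter fun z =>
        |level (v i) (c i) k z| ≤ N ∧ |level (v j) (c j) k z| ≤ N).card : ℝ) *
        ((2 * (R * k : ℕ) + 1 : ℕ) : ℝ) ^ 2 ≤
        (2 * N + 1) ^ 2 * ((2 * (R * k : ℕ) + 1 : ℕ) : ℝ) ^ n := by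
      exact_mod_cast card_slab_inter_slab_le hab (R * k) N (k * c i) (k * c j)
    calc _ ≤ _ := mul_le_mul_of_nonneg_left
          (pow_le_pow_left₀ (Nat.cast_nonneg _) (le_two_mul_add_one hR k) 2) (Nat.cast_nonneg _)
      _ ≤ _ := h1
      _ ≤ (2 * N + 1) ^ 2 * ((2 * R + 1 : ℝ) ^ n * (k : ℝ) ^ n) :=
        mul_le_mul_of_nonneg_left (pow_le_of_two_mul_add_one R hk n) (by positivity)
      _ = _ := by ring
  · -- Opposite facets of the scaled polytope are eventually further apart than `2 * N`.
    refine ⟨0, ?_⟩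
    filter_upwards [eventually_gt_atTop (2 * N)] with k hk
    rw [Finset.filter_eq_empty_iff.2]
    · simp
    rintro z - ⟨h1, h2⟩
    rw [level, abs_le] at h1 h2
    rw [hv, neg_dotProduct] at h2
    have h3 : (k : ℤ) * (c i + c j) ≤ k * (-1) :=
      mul_le_mul_of_nonneg_left (by omega) (by positivity)
    have h4 : (2 * N : ℤ) < k := by exact_mod_cast hk
    linarith [h1.1, h1.2, h2.1, h2.2]

/-- A sum over lattice points in a box of size `O(k)` is `O(k ^ (n - 2))` if its terms are bounded,
are `O(1 / k)` where at most one facet is near and `O(1 / k ^ 2)` where none is near. -/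
theorem IsFacetSystem.exists_abs_sum_le {ι : Type*} [Fintype ι] {K : Set (Fin n → ℝ)}
    {v : ι → Fin n → ℤ} {c : ι → ℤ} (hF : IsFacetSystem K v c) {R : ℕ} (hR : 1 ≤ R) (N : ℕ)
    (B : ℝ) : ∃ C : ℝ, ∀ᶠ k : ℕ in atTop, ∀ a : (Fin n → ℤ) → ℝ,
      (∀ z, |a z| ≤ B) →
      (∀ z i, (∀ j, j ≠ i → (N : ℤ) < |level (v j) (c j) k z|) → |a z| ≤ B / k) →
      (∀ z, (∀ j, (N : ℤ) < |level (v j) (c j) k z|) → |a z| ≤ B / (k : ℝ) ^ 2) →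
      |∑ z ∈ latticeBox n (R * k), a z| * (k : ℝ) ^ 2 ≤ C * (k : ℝ) ^ n := by
  classical
  choose C₁ hC₁ using fun i => exists_card_near_facet_le
    (ne_zero_of_gcd_eq_one (hF.gcd_eq_one i)) (c i) hR N
  have h2 : ∀ i j, ∃ C : ℝ, i ≠ j → ∀ᶠ k : ℕ in atTop,
      (((latticeBox n (R * k)).filter fun z =>
        |level (v i) (c i) k z| ≤ N ∧ |level (v j) (c j) k z| ≤ N).card : ℝ) * (k : ℝ) ^ 2 ≤
        C * (k : ℝ) ^ n := fun i j => by
    by_cases hij : i = j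
    · exact ⟨0, fun h => absurd hij h⟩
    · obtain ⟨C, hC⟩ := hF.exists_card_near_two_facets_le hij hR N
      exact ⟨C, fun _ => hC⟩
  choose C₂ hC₂ using h2
  refine ⟨B * ((2 * R + 1 : ℝ) ^ n + ∑ i, C₁ i + ∑ i, ∑ j, if i ≠ j then C₂ i j else 0), ?_⟩
  have hC₂' : ∀ᶠ k : ℕ in atTop, ∀ i j, i ≠ j →
      (((latticeBox n (R * k)).filter fun z =>
        |level (v i) (c i) k z| ≤ N ∧ |level (v j) (c j) k z| ≤ N).card : ℝ) * (k : ℝ) ^ 2 ≤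
        C₂ i j * (k : ℝ) ^ n :=
    eventually_all.2 fun i => eventually_all.2 fun j => by
      by_cases hij : i = j
      · exact Eventually.of_forall fun k h => absurd hij h
      · exact (hC₂ i j hij).mono fun k hk _ => hk
  filter_upwards [hC₂', eventually_ge_atTop 1] with k hk₂ hk a h0 h1 h2
  have hB : 0 ≤ B := (abs_nonneg _).trans (h0 0)
  have hkpos : (0 : ℝ) < k := by exact_mod_cast hk
  -- The three sums account for all points, points near a facet, and points near two facets.
  have hpt : ∀ z, |a z| ≤ B / (k : ℝ) ^ 2 +
      ∑ i, (if |level (v i) (c i) k z| ≤ N then B / k else 0) +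
      ∑ i, ∑ j, (if i ≠ j then (if |level (v i) (c i) k z| ≤ N ∧ |level (v j) (c j) k z| ≤ N
        then B else 0) else 0) := by
    intro z
    have hs1 : ∀ i ∈ Finset.univ,
        (0 : ℝ) ≤ if |level (v i) (c i) k z| ≤ N then B / k else 0 := fun i _ => by
      split_ifs <;> positivity
    have hs2 : ∀ i ∈ Finset.univ, ∀ j ∈ Finset.univ,
        (0 : ℝ) ≤ if i ≠ j then (if |level (v i) (c i) k z| ≤ N ∧ |level (v j) (c j) k z| ≤ N
        then B else 0) else 0 := fun i _ j _ => by
      split_ifs <;> positivity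
    have hs1' := Finset.sum_nonneg hs1
    have hs2' := Finset.sum_nonneg fun i hi => Finset.sum_nonneg (hs2 i hi)
    have hs0 : 0 ≤ B / (k : ℝ) ^ 2 := by positivity
    by_cases hfar : ∀ j, (N : ℤ) < |level (v j) (c j) k z|
    · linarith [h2 z hfar]
    push Not at hfar
    obtain ⟨i, hi⟩ := hfar
    by_cases hfar' : ∀ j, j ≠ i → (N : ℤ) < |level (v j) (c j) k z|
    · have h3 := Finset.single_le_sum hs1 (Finset.mem_univ i)
      rw [if_pos hi] at h3
      linarith [h1 z i hfar']
    push Not at hfar'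
    obtain ⟨j, hji, hj⟩ := hfar'
    have h3 := Finset.single_le_sum (hs2 i (Finset.mem_univ i)) (Finset.mem_univ j)
    have h4 := Finset.single_le_sum (fun i hi => Finset.sum_nonneg (hs2 i hi))
      (Finset.mem_univ i)
    rw [if_pos hji.symm, if_pos ⟨hi, hj⟩] at h3
    linarith [h0 z]
  have hsum : |∑ z ∈ latticeBox n (R * k), a z| ≤
      (latticeBox n (R * k)).card * (B / (k : ℝ) ^ 2) +
      ∑ i, (((latticeBox n (R * k)).filter fun z => |level (v i) (c i) k z| ≤ N).card : ℝ) *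
        (B / k) +
      ∑ i, ∑ j, if i ≠ j then (((latticeBox n (R * k)).filter fun z =>
        |level (v i) (c i) k z| ≤ N ∧ |level (v j) (c j) k z| ≤ N).card : ℝ) * B else 0 := by
    refine (Finset.abs_sum_le_sum_abs _ _).trans ((Finset.sum_le_sum fun z _ => hpt z).trans
      (le_of_eq ?_))
    rw [Finset.sum_add_distrib, Finset.sum_add_distrib, Finset.sum_const, nsmul_eq_mul]
    congr 1
    · congr 1
      rw [Finset.sum_comm]
      refine Finset.sum_congr rfl fun i _ => ?_
      rw [← Finset.sum_filter, Finset.sum_const, nsmul_eq_mul]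
    · rw [Finset.sum_comm]
      refine Finset.sum_congr rfl fun i _ => ?_
      rw [Finset.sum_comm]
      refine Finset.sum_congr rfl fun j _ => ?_
      by_cases hij : i ≠ j
      · simp only [if_pos hij]
        rw [← Finset.sum_filter, Finset.sum_const, nsmul_eq_mul]
      · simp only [if_neg hij, Finset.sum_const_zero]
  calc _ ≤ _ := mul_le_mul_of_nonneg_right hsum (by positivity : (0 : ℝ) ≤ (k : ℝ) ^ 2)
    _ = B * ((latticeBox n (R * k)).card +
        ∑ i, (((latticeBox n (R * k)).filter fun z => |level (v i) (c i) k z| ≤ N).card : ℝ) * k +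
        ∑ i, ∑ j, if i ≠ j then (((latticeBox n (R * k)).filter fun z =>
          |level (v i) (c i) k z| ≤ N ∧ |level (v j) (c j) k z| ≤ N).card : ℝ) * (k : ℝ) ^ 2
          else 0) := by
      simp only [add_mul, mul_add, Finset.sum_mul, Finset.mul_sum, ite_mul, mul_ite, zero_mul,
        mul_zero]
      congr 1
      · congr 1
        · field_simp
        · refine Finset.sum_congr rfl fun i _ => ?_
          field_simp
      · refine Finset.sum_congr rfl fun i _ => Finset.sum_congr rfl fun j _ => ?_
        split_ifs <;> ring
    _ ≤ B * ((2 * R + 1 : ℝ) ^ n * (k : ℝ) ^ n + ∑ i, C₁ i * (k : ℝ) ^ n +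
        ∑ i, ∑ j, if i ≠ j then C₂ i j * (k : ℝ) ^ n else 0) := by
      refine mul_le_mul_of_nonneg_left (add_le_add (add_le_add ?_ ?_) ?_) hB
      · rw [card_latticeBox, Nat.cast_pow]
        exact pow_le_of_two_mul_add_one R hk n
      · exact Finset.sum_le_sum fun i _ => hC₁ i k hk
      · refine Finset.sum_le_sum fun i _ => Finset.sum_le_sum fun j _ => ?_
        by_cases hij : i ≠ j
        · simp only [if_pos hij]; exact hk₂ i j hij
        · simp only [if_neg hij]; exact le_rfl
    _ = _ := by
      simp only [mul_add, add_mul, Finset.mul_sum, Finset.sum_mul, mul_ite, ite_mul, mul_zero,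
        zero_mul, mul_assoc]

/-! ### Integrals as averages of lattice sums -/

/-- The half-open unit cube `[0, 1)ⁿ`. -/
def unitCube (n : ℕ) : Set (Fin n → ℝ) := {u | ∀ i, ⌊u i⌋ = 0}

theorem unitCube_eq_pi : unitCube n = Set.univ.pi fun _ : Fin n => Set.Ico (0 : ℝ) 1 := by
  ext u
  simp [unitCube, Int.floor_eq_zero_iff]

theorem measurableSet_unitCube : MeasurableSet (unitCube n) := by
  rw [unitCube_eq_pi]
  exact MeasurableSet.univ_pi fun _ => measurableSet_Ico

theorem volume_unitCube : volume (unitCube n) = 1 := by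
  rw [unitCube_eq_pi, volume_pi_pi]
  simp

theorem abs_le_one_of_mem_unitCube {u : Fin n → ℝ} (hu : u ∈ unitCube n) (i : Fin n) :
    |u i| ≤ 1 := by
  have h := Int.floor_eq_zero_iff.1 (hu i)
  rw [abs_le]
  exact ⟨by linarith [h.1], h.2.le⟩

/-- The translates of the unit cube by `ℤⁿ` tile `ℝⁿ`. -/
theorem integral_eq_tsum_unitCube {g : (Fin n → ℝ) → ℝ} (hg : Integrable g) :
    ∫ y, g y = ∑' z : Fin n → ℤ, ∫ u in unitCube n, g (toReal z + u) := by
  let cell : (Fin n → ℤ) → Set (Fin n → ℝ) := fun z => {x | ∀ i, ⌊x i⌋ = z i}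
  have hmeas : ∀ z, MeasurableSet (cell z) := fun z => by
    have : cell z = ⋂ i, {x : Fin n → ℝ | ⌊x i⌋ = z i} := by ext; simp [cell]
    rw [this]
    exact MeasurableSet.iInter fun i =>
      (Int.measurable_floor.comp (measurable_pi_apply i)) (measurableSet_singleton (z i))
  have hdisj : Pairwise (Function.onFun Disjoint cell) := fun z z' hne => by
    refine Set.disjoint_left.2 fun x hx hx' => hne ?_
    ext i
    rw [← hx i, ← hx' i]
  have huniv : ⋃ z, cell z = Set.univ :=
    Set.eq_univ_of_forall fun x => Set.mem_iUnion.2 ⟨fun i => ⌊x i⌋, fun _ => rfl⟩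
  rw [← setIntegral_univ, ← huniv, integral_iUnion hmeas hdisj hg.integrableOn]
  refine tsum_congr fun z => ?_
  rw [← integral_indicator (hmeas z), ← integral_indicator measurableSet_unitCube,
    ← integral_add_left_eq_self _ (toReal z)]
  congr 1
  ext u
  have hiff : toReal z + u ∈ cell z ↔ u ∈ unitCube n := by
    simp [cell, unitCube, toReal]
  by_cases hu : u ∈ unitCube n
  · rw [Set.indicator_of_mem hu, Set.indicator_of_mem (hiff.2 hu)]
  · rw [Set.indicator_of_notMem hu, Set.indicator_of_notMem fun h => hu (hiff.1 h)]

theorem mem_latticeBox_of_norm_le {ρ : ℝ} {R k D : ℕ} (hk : 1 ≤ k) (hR : ρ + D ≤ R)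
    {z : Fin n → ℤ} {d : Fin n → ℝ} (hd : ∀ i, |d i| ≤ D)
    (h : ‖(k : ℝ)⁻¹ • (toReal z + d)‖ ≤ ρ) : z ∈ latticeBox n (R * k) := by
  have hk' : (1 : ℝ) ≤ k := by exact_mod_cast hk
  rw [mem_latticeBox]
  intro i
  have h1 := (norm_le_pi_norm ((k : ℝ)⁻¹ • (toReal z + d)) i).trans h
  rw [Pi.smul_apply, smul_eq_mul, Real.norm_eq_abs, abs_mul, abs_inv, Nat.abs_cast,
    inv_mul_le_iff₀ (by linarith), Pi.add_apply] at h1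
  have h2 : |(z i : ℝ)| ≤ |toReal z i + d i| + |d i| := by
    have := abs_sub (toReal z i + d i) (d i)
    simpa [toReal] using this
  have h3 : (D : ℝ) ≤ k * D := le_mul_of_one_le_left (Nat.cast_nonneg _) hk'
  have h4 : |(z i : ℝ)| ≤ R * k := by
    calc |(z i : ℝ)| ≤ k * ρ + k * D := by linarith [hd i]
      _ = k * (ρ + D) := by ring
      _ ≤ k * R := mul_le_mul_of_nonneg_left hR (by linarith)
      _ = R * k := mul_comm _ _
  exact_mod_cast h4

/-- The integral is the average, over displacements `u` in the unit cube, of the lattice sums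
displaced by `u`. The box contains every lattice point that contributes. -/
theorem pow_mul_integral_eq {f : (Fin n → ℝ) → ℝ} (hf : Integrable f) {ρ : ℝ}
    (hsupp : ∀ x, f x ≠ 0 → ‖x‖ ≤ ρ) {R k : ℕ} (hk : 1 ≤ k) (hR : ρ + 1 ≤ R) :
    IntegrableOn (fun u => ∑ z ∈ latticeBox n (R * k), f ((k : ℝ)⁻¹ • (toReal z + u)))
      (unitCube n) ∧
    (k : ℝ) ^ n * ∫ x, f x =
      ∫ u in unitCube n, ∑ z ∈ latticeBox n (R * k), f ((k : ℝ)⁻¹ • (toReal z + u)) := by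
  have hk' : (0 : ℝ) < k := by exact_mod_cast hk
  have hg : Integrable fun y => f ((k : ℝ)⁻¹ • y) := hf.comp_smul (inv_ne_zero hk'.ne')
  have hint : ∀ z ∈ latticeBox n (R * k),
      IntegrableOn (fun u => f ((k : ℝ)⁻¹ • (toReal z + u))) (unitCube n) :=
    fun z _ => (hg.comp_add_left (toReal z)).integrableOn
  refine ⟨integrable_finsetSum _ hint, ?_⟩
  rw [integral_finsetSum _ hint]
  have h1 := Measure.integral_comp_smul volume f (k : ℝ)⁻¹
  rw [Module.finrank_fin_fun, inv_pow, inv_inv, abs_of_pos (by positivity), smul_eq_mul] at h1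
  rw [← h1, integral_eq_tsum_unitCube hg]
  refine tsum_eq_sum fun z hz => ?_
  rw [setIntegral_congr_fun (g := fun _ => (0 : ℝ)) measurableSet_unitCube, integral_zero]
  intro u hu
  by_contra hne
  exact hz (mem_latticeBox_of_norm_le (D := 1) hk (by simpa using hR)
    (by simpa using abs_le_one_of_mem_unitCube hu) (hsupp _ hne))

/-- The displacement `-u` may be used in place of `u`; averaging the two cancels the first-order
term in the interior. -/
theorem pow_mul_integral_eq_sub {f : (Fin n → ℝ) → ℝ} (hf : Integrable f) {ρ : ℝ}
    (hsupp : ∀ x, f x ≠ 0 → ‖x‖ ≤ ρ) {R k : ℕ} (hk : 1 ≤ k) (hR : ρ + 1 ≤ R) :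
    IntegrableOn (fun u => ∑ z ∈ latticeBox n (R * k), f ((k : ℝ)⁻¹ • (toReal z + -u)))
      (unitCube n) ∧
    (k : ℝ) ^ n * ∫ x, f x =
      ∫ u in unitCube n, ∑ z ∈ latticeBox n (R * k), f ((k : ℝ)⁻¹ • (toReal z + -u)) := by
  have h := pow_mul_integral_eq (f := fun x => f (-x)) hf.comp_neg
    (fun x hx => by simpa using hsupp _ hx) hk hR
  rw [integral_neg_eq_self f] at h
  have hfun : (fun u => ∑ z ∈ latticeBox n (R * k), f (-((k : ℝ)⁻¹ • (toReal z + u)))) =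
      fun u => ∑ z ∈ latticeBox n (R * k), f ((k : ℝ)⁻¹ • (toReal z + -u)) := by
    ext u
    refine Finset.sum_equiv (Equiv.neg _) (fun z => ?_) fun z _ => ?_
    · simp [mem_latticeBox]
    · congr 1
      rw [← smul_neg]
      congr 1
      ext i
      simp [toReal]
      ring
  rwa [hfun] at h

/-- A lattice sum is invariant under translation by a bounded lattice vector. -/
theorem sum_latticeBox_add {f : (Fin n → ℝ) → ℝ} {ρ : ℝ}
    (hsupp : ∀ x, f x ≠ 0 → ‖x‖ ≤ ρ) {R k D : ℕ} (hk : 1 ≤ k) (hR : ρ + D ≤ R)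
    {d : Fin n → ℤ} (hd : ∀ i, |d i| ≤ D) :
    ∑ z ∈ latticeBox n (R * k), f ((k : ℝ)⁻¹ • (toReal z + toReal d)) =
      ∑ᶠ z : Fin n → ℤ, f ((k : ℝ)⁻¹ • toReal z) := by
  rw [← finsum_comp_equiv (Equiv.addRight d)]
  have hadd : ∀ z, toReal (Equiv.addRight d z) = toReal z + toReal d := fun z => by
    ext i; simp [toReal]
  simp_rw [hadd]
  refine (finsum_eq_sum_of_support_subset _ fun z hz => ?_).symm
  refine Finset.mem_coe.2 (mem_latticeBox_of_norm_le hk hR (fun i => ?_) (hsupp _ hz))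
  have := hd i
  simp only [toReal]
  exact_mod_cast this

/-! ### The measure of a facet -/

theorem volume_pairing_eq {v : Fin n → ℤ} (hv : v ≠ 0) (t : ℝ) :
    volume {x : Fin n → ℝ | pairing v x = t} = 0 := by
  have hpos := one_le_pairing_self hv
  set w : Fin n → ℝ := (t / pairing v (toReal v)) • toReal v with hw
  have hw' : pairing v w = t := by
    rw [hw, map_smul, smul_eq_mul, div_mul_cancel₀ _ (by linarith)]
  have h1 : {x : Fin n → ℝ | pairing v x = t} =
      (fun x => x + -w) ⁻¹' (LinearMap.ker (pairing v) : Set (Fin n → ℝ)) := by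
    ext x
    simp [hw', ← sub_eq_add_neg, sub_eq_zero]
  rw [h1, measure_preimage_add_right]
  refine Measure.addHaar_submodule _ _ fun h => pairing_ne_zero hv (LinearMap.ker_eq_top.1 h)

theorem facetFun_add_smul (K : Set (Fin n → ℝ)) (v : Fin n → ℤ) (x y : Fin n → ℝ) (t : ℝ) :
    facetFun K v (x + t • y) = facetFun K v x + t * pairing v y := by
  rw [facetFun, facetFun, ← pairing_apply, ← pairing_apply, map_add, map_smul, smul_eq_mul]
  ring

theorem facetProj_add_smul (K : Set (Fin n → ℝ)) {v : Fin n → ℤ} (hv : v ≠ 0) (x : Fin n → ℝ)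
    (t : ℝ) : facetProj K v (x + t • toReal v) = facetProj K v x := by
  have hpos := one_le_pairing_self hv
  rw [facetProj, facetProj, facetFun_add_smul, ← pairing_apply, add_div,
    mul_div_cancel_right₀ _ (by linarith)]
  module

theorem continuous_facetFun (K : Set (Fin n → ℝ)) (v : Fin n → ℤ) :
    Continuous (facetFun K v) :=
  (continuous_pairing v).sub continuous_const

theorem continuous_facetProj (K : Set (Fin n → ℝ)) (v : Fin n → ℤ) :
    Continuous (facetProj K v) :=
  continuous_id.sub (((continuous_facetFun K v).div_const _).smul continuous_const)

/-- A function that is constant along the normal direction has the same integral over each of the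
`k` slabs into which `0 ≤ l < 1` is divided. -/
theorem setIntegral_slab {K : Set (Fin n → ℝ)} {v : Fin n → ℤ} (hv : v ≠ 0)
    {g : (Fin n → ℝ) → ℝ}
    (hg : IntegrableOn (fun x => g (facetProj K v x))
      {x | 0 ≤ facetFun K v x ∧ facetFun K v x ≤ 1}) {k : ℕ} (hk : 1 ≤ k) :
    ∫ x in {x | 0 ≤ facetFun K v x ∧ facetFun K v x ≤ 1}, g (facetProj K v x) =
      k * ∫ x in {x | 0 ≤ k * facetFun K v x ∧ k * facetFun K v x < 1}, g (facetProj K v x) := by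
  have hk' : (0 : ℝ) < k := by exact_mod_cast hk
  have hcont := continuous_facetFun K v
  have hpos := one_le_pairing_self hv
  let S : ℕ → Set (Fin n → ℝ) := fun m =>
    {x | m ≤ k * facetFun K v x ∧ k * facetFun K v x < m + 1}
  have hS : ∀ m, MeasurableSet (S m) := fun m =>
    (measurableSet_le measurable_const (hcont.measurable.const_mul _)).inter
      (measurableSet_lt (hcont.measurable.const_mul _) measurable_const)
  have hunion : {x | 0 ≤ facetFun K v x ∧ facetFun K v x < 1} = ⋃ m ∈ Finset.range k, S m := by
    ext x
    simp only [Set.mem_iUnion, Finset.mem_range, exists_prop, S, Set.mem_ofPred_eq]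
    constructor
    · rintro ⟨h0, h1⟩
      have h2 : 0 ≤ k * facetFun K v x := by positivity
      refine ⟨⌊k * facetFun K v x⌋₊, ?_, Nat.floor_le h2, Nat.lt_floor_add_one _⟩
      rw [Nat.floor_lt h2]
      nlinarith
    · rintro ⟨m, hm, h0, h1⟩
      have hm' : (m : ℝ) + 1 ≤ k := by exact_mod_cast hm
      constructor
      · by_contra h
        push Not at h
        have : (0 : ℝ) ≤ m := Nat.cast_nonneg m
        nlinarith
      · by_contra h
        push Not at h
        nlinarith
  have hdisj : ∀ m m', m ≠ m' → Disjoint (S m) (S m') := fun m m' hne => by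
    refine Set.disjoint_left.2 fun x hx hx' => hne ?_
    have h1 : (m : ℝ) < m' + 1 := hx.1.trans_lt hx'.2
    have h2 : (m' : ℝ) < m + 1 := hx'.1.trans_lt hx.2
    have h1' : m < m' + 1 := by exact_mod_cast h1
    have h2' : m' < m + 1 := by exact_mod_cast h2
    omega
  have hae : {x | 0 ≤ facetFun K v x ∧ facetFun K v x ≤ 1} =ᵐ[volume]
      {x | 0 ≤ facetFun K v x ∧ facetFun K v x < 1} := by
    have hnull : ∀ᵐ x : Fin n → ℝ, pairing v x ≠ 1 + sInf ((fun y => toReal v ⬝ᵥ y) '' K) := by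
      rw [ae_iff]
      simpa using volume_pairing_eq hv (1 + sInf ((fun y => toReal v ⬝ᵥ y) '' K))
    filter_upwards [hnull] with x hx
    have hx' : facetFun K v x ≠ 1 := fun h => hx (by
      rw [facetFun, ← pairing_apply] at h
      linarith)
    have : (0 ≤ facetFun K v x ∧ facetFun K v x ≤ 1) =
        (0 ≤ facetFun K v x ∧ facetFun K v x < 1) := by
      rw [lt_iff_le_and_ne]
      simp [hx']
    exact this
  have hslab : ∀ m, ∫ x in S m, g (facetProj K v x) = ∫ x in S 0, g (facetProj K v x) := by
    intro m
    set t : ℝ := m / k / pairing v (toReal v) with ht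
    rw [← integral_indicator (hS m), ← integral_indicator (hS 0),
      ← integral_add_right_eq_self _ (t • toReal v)]
    congr 1
    ext x
    have hl : k * facetFun K v (x + t • toReal v) = k * facetFun K v x + m := by
      rw [facetFun_add_smul, ht, div_mul_cancel₀ _ (by linarith)]
      field_simp
    have hiff : x + t • toReal v ∈ S m ↔ x ∈ S 0 := by
      simp only [S, Set.mem_ofPred_eq, hl, Nat.cast_zero]
      constructor <;> rintro ⟨h1, h2⟩ <;> constructor <;> linarith
    by_cases hx : x ∈ S 0
    · rw [Set.indicator_of_mem hx, Set.indicator_of_mem (hiff.2 hx), facetProj_add_smul K hv]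
    · rw [Set.indicator_of_notMem hx, Set.indicator_of_notMem fun h => hx (hiff.1 h)]
  have hS0 : S 0 = {x | 0 ≤ k * facetFun K v x ∧ k * facetFun K v x < 1} := by
    simp [S]
  have hsub : ∀ m ∈ Finset.range k, S m ⊆ {x | 0 ≤ facetFun K v x ∧ facetFun K v x ≤ 1} := by
    intro m hm x hx
    have : x ∈ {x | 0 ≤ facetFun K v x ∧ facetFun K v x < 1} := by
      rw [hunion]; exact Set.mem_biUnion hm hx
    exact ⟨this.1, this.2.le⟩
  rw [setIntegral_congr_set hae, hunion, integral_biUnion_finset _ (fun m _ => hS m)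
    (fun m _ m' _ h => hdisj m m' h) (fun m hm => hg.mono_set (hsub m hm)),
    Finset.sum_congr rfl fun m _ => hslab m, Finset.sum_const, Finset.card_range, nsmul_eq_mul,
    hS0]

variable {ι : Type*}

/-! ### Membership of displaced lattice points -/

/-- The function `h` on `K` is bounded, Lipschitz, and has second differences of second order, all
with the constant `M`. -/
structure HasSecondOrderBound (K : Set (Fin n → ℝ)) (h : (Fin n → ℝ) → ℝ) (M : ℝ) : Prop where
  abs_le : ∀ x ∈ K, |h x| ≤ M
  abs_sub_le : ∀ x ∈ K, ∀ y ∈ K, |h x - h y| ≤ M * ‖x - y‖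
  abs_second_difference_le : ∀ x d, x ∈ K → x + d ∈ K → x + -d ∈ K →
    |h x - 1 / 2 * h (x + d) - 1 / 2 * h (x + -d)| ≤ M * ‖d‖ ^ 2

theorem pairing_scaled {v : Fin n → ℤ} (c : ℤ) {k : ℕ} (hk : 1 ≤ k) (z : Fin n → ℤ)
    (d : Fin n → ℝ) : k * (pairing v ((k : ℝ)⁻¹ • (toReal z + d)) - c) =
      level v c k z + pairing v d := by
  have hk' : (k : ℝ) ≠ 0 := by positivity
  rw [map_smul, map_add, pairing_toReal, level, smul_eq_mul, mul_sub, mul_inv_cancel_left₀ hk']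
  push_cast
  ring

theorem le_pairing_scaled_iff {v : Fin n → ℤ} {c : ℤ} {k : ℕ} (hk : 1 ≤ k) {z : Fin n → ℤ}
    {d : Fin n → ℝ} : (c : ℝ) ≤ pairing v ((k : ℝ)⁻¹ • (toReal z + d)) ↔
      0 ≤ (level v c k z : ℝ) + pairing v d := by
  have hk' : (0 : ℝ) < k := by exact_mod_cast hk
  rw [← pairing_scaled c hk, mul_nonneg_iff_of_pos_left hk', sub_nonneg]

theorem pairing_scaled_eq_iff {v : Fin n → ℤ} {c : ℤ} {k : ℕ} (hk : 1 ≤ k) {z : Fin n → ℤ}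
    {d : Fin n → ℝ} : pairing v ((k : ℝ)⁻¹ • (toReal z + d)) = c ↔
      (level v c k z : ℝ) + pairing v d = 0 := by
  have hk' : (k : ℝ) ≠ 0 := by positivity
  rw [← pairing_scaled c hk, mul_eq_zero, or_iff_right hk', sub_eq_zero]

theorem zero_le_add_iff_of_far {a : ℤ} {N : ℕ} {t : ℝ} (ha : (N : ℤ) < |a|) (ht : |t| ≤ N) :
    0 ≤ (a : ℝ) + t ↔ 0 < a := by
  have ha' : (N : ℝ) < |(a : ℝ)| := by exact_mod_cast ha
  rw [abs_le] at ht
  constructor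
  · intro h
    by_contra hneg
    push Not at hneg
    have h1 : (a : ℝ) ≤ 0 := by exact_mod_cast hneg
    rw [abs_of_nonpos h1] at ha'
    linarith [ht.2]
  · intro h
    have h1 : (0 : ℝ) < a := by exact_mod_cast h
    rw [abs_of_pos h1] at ha'
    linarith [ht.1]

variable {K : Set (Fin n → ℝ)} {v : ι → Fin n → ℤ} {c : ι → ℤ}

/-- Away from all facets, a bounded displacement does not change membership in the polytope. -/
theorem IsFacetSystem.scaled_mem_iff_of_far (hF : IsFacetSystem K v c) {k N : ℕ} (hk : 1 ≤ k)
    {z : Fin n → ℤ} (hz : ∀ j, (N : ℤ) < |level (v j) (c j) k z|) {d : Fin n → ℝ}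
    (hd : ∀ j, |pairing (v j) d| ≤ N) :
    (k : ℝ)⁻¹ • (toReal z + d) ∈ K ↔ ∀ j, 0 < level (v j) (c j) k z := by
  rw [hF.mem_iff]
  exact forall_congr' fun j =>
    (le_pairing_scaled_iff hk).trans (zero_le_add_iff_of_far (hz j) (hd j))

/-- Near one facet only, membership of a displaced point in the polytope is decided by the side of
that facet. -/
theorem IsFacetSystem.scaled_mem_iff_of_far_except (hF : IsFacetSystem K v c) {k N : ℕ}
    (hk : 1 ≤ k) {z : Fin n → ℤ} {i : ι} (hz : ∀ j, j ≠ i → (N : ℤ) < |level (v j) (c j) k z|)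
    {d : Fin n → ℝ} (hd : ∀ j, |pairing (v j) d| ≤ N) :
    (k : ℝ)⁻¹ • (toReal z + d) ∈ K ↔ (∀ j, j ≠ i → 0 < level (v j) (c j) k z) ∧
      0 ≤ (level (v i) (c i) k z : ℝ) + pairing (v i) d := by
  rw [hF.mem_iff]
  constructor
  · intro h
    exact ⟨fun j hj => (zero_le_add_iff_of_far (hz j hj) (hd j)).1
      ((le_pairing_scaled_iff hk).1 (h j)), (le_pairing_scaled_iff hk).1 (h i)⟩
  · rintro ⟨h1, h2⟩ j
    rw [le_pairing_scaled_iff hk]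
    by_cases hj : j = i
    · subst hj; exact h2
    · exact (zero_le_add_iff_of_far (hz j hj) (hd j)).2 (h1 j hj)

variable {h : (Fin n → ℝ) → ℝ} {M : ℝ}

theorem HasSecondOrderBound.nonneg (hh : HasSecondOrderBound K h M) (hne : K.Nonempty) :
    0 ≤ M := by
  obtain ⟨x, hx⟩ := hne
  exact (abs_nonneg _).trans (hh.abs_le x hx)

theorem HasSecondOrderBound.abs_scaled_sub_le (hh : HasSecondOrderBound K h M)
    (hne : K.Nonempty) {k D : ℕ} {z : Fin n → ℤ} {d d' : Fin n → ℝ}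
    (hx : (k : ℝ)⁻¹ • (toReal z + d) ∈ K) (hx' : (k : ℝ)⁻¹ • (toReal z + d') ∈ K)
    (hd : ‖d‖ ≤ D) (hd' : ‖d'‖ ≤ D) :
    |h ((k : ℝ)⁻¹ • (toReal z + d)) - h ((k : ℝ)⁻¹ • (toReal z + d'))| ≤ 2 * M * D / k := by
  refine (hh.abs_sub_le _ hx _ hx').trans ?_
  rw [← smul_sub, add_sub_add_left_eq_sub, norm_smul, norm_inv, Real.norm_natCast]
  have h1 : ‖d - d'‖ ≤ 2 * D := (norm_sub_le _ _).trans (by linarith)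
  have hM := hh.nonneg hne
  calc M * ((k : ℝ)⁻¹ * ‖d - d'‖) ≤ M * ((k : ℝ)⁻¹ * (2 * D)) := by gcongr
    _ = _ := by ring

theorem HasSecondOrderBound.abs_indicator_le (hh : HasSecondOrderBound K h M)
    (hne : K.Nonempty) {F : Set (Fin n → ℝ)} (hFK : F ⊆ K) (x : Fin n → ℝ) :
    |F.indicator h x| ≤ M := by
  by_cases hx : x ∈ F
  · rw [Set.indicator_of_mem hx]; exact hh.abs_le x (hFK hx)
  · rw [Set.indicator_of_notMem hx, abs_zero]; exact hh.nonneg hne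

/-! ### The trapezoidal defect near a facet -/

/-- The indicator of `0 ≤ t`. -/
noncomputable def heaviside (t : ℝ) : ℝ := if 0 ≤ t then 1 else 0

theorem heaviside_mem (t : ℝ) : 0 ≤ heaviside t ∧ heaviside t ≤ 1 := by
  unfold heaviside; split_ifs <;> norm_num

/-- The difference at level `J` between the indicator of a half-line and the average of its
translates by `s` and `-s`. -/
noncomputable def trapezoidWeight (s : ℝ) (J : ℤ) : ℝ :=
  heaviside J - 1 / 2 * heaviside (J + s) - 1 / 2 * heaviside (J + -s)

theorem abs_trapezoidWeight_le (s : ℝ) (J : ℤ) : |trapezoidWeight s J| ≤ 1 := by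
  have h1 := heaviside_mem J
  have h2 := heaviside_mem (J + s)
  have h3 := heaviside_mem (J + -s)
  rw [trapezoidWeight, abs_le]
  constructor <;> linarith

theorem sum_heaviside {N : ℕ} {t : ℝ} (ht : |t| ≤ N) :
    ∑ J ∈ Finset.Icc (-(N : ℤ)) N, heaviside (J + t) = N + 1 + ⌊t⌋ := by
  rw [abs_le] at ht
  have h1 : -(N : ℤ) ≤ ⌊t⌋ := Int.le_floor.2 (by push_cast; exact ht.1)
  have h2 : ⌊t⌋ ≤ (N : ℤ) := by
    have h3 : (⌊t⌋ : ℝ) ≤ N := (Int.floor_le t).trans ht.2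
    exact_mod_cast h3
  have h3 : ∀ J : ℤ, heaviside (J + t) = if J ∈ Finset.Icc (-⌊t⌋) N ∨ (N : ℤ) < J
      then 1 else 0 := by
    intro J
    have : (0 ≤ (J : ℝ) + t) ↔ -⌊t⌋ ≤ J := by
      rw [neg_le, Int.le_floor]
      push_cast
      constructor <;> intro h <;> linarith
    unfold heaviside
    refine if_congr ?_ rfl rfl
    rw [this, Finset.mem_Icc]
    omega
  simp_rw [h3]
  rw [← Finset.sum_filter, Finset.sum_const, nsmul_eq_mul, mul_one]
  have h4 : (Finset.Icc (-(N : ℤ)) N).filter (fun J => J ∈ Finset.Icc (-⌊t⌋) N ∨ (N : ℤ) < J) =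
      Finset.Icc (-⌊t⌋) N := by
    ext J
    simp only [Finset.mem_filter, Finset.mem_Icc]
    omega
  rw [h4]
  have h5 : ((Finset.Icc (-⌊t⌋) (N : ℤ)).card : ℤ) = N + 1 + ⌊t⌋ := by
    rw [Int.card_Icc]; omega
  exact_mod_cast h5

/-- The total weight is `1 / 2` for every non-integral displacement, since
`⌊s⌋ + ⌊-s⌋ = -1`. -/
theorem sum_trapezoidWeight {N : ℕ} {s : ℝ} (hs : |s| ≤ N) (hint : ∀ m : ℤ, s ≠ m) :
    ∑ J ∈ Finset.Icc (-(N : ℤ)) N, trapezoidWeight s J = 1 / 2 := by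
  have h0 := sum_heaviside (N := N) (t := 0) (by simp)
  simp only [add_zero, Int.floor_zero, Int.cast_zero] at h0
  simp only [trapezoidWeight, Finset.sum_sub_distrib, ← Finset.mul_sum]
  rw [h0, sum_heaviside hs, sum_heaviside (by rwa [abs_neg])]
  have h1 : ⌊-s⌋ = -⌊s⌋ - 1 := by
    rw [Int.floor_eq_iff]
    have h2 := Int.floor_le s
    have h3 := Int.lt_floor_add_one s
    have h4 : (⌊s⌋ : ℝ) < s := lt_of_le_of_ne h2 fun h => hint _ h.symm
    push_cast
    constructor <;> linarith
  rw [h1]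
  push_cast
  ring

theorem trapezoidWeight_eq_zero {N : ℕ} {s : ℝ} (hs : |s| ≤ N) {J : ℤ} (hJ : (N : ℤ) < |J|) :
    trapezoidWeight s J = 0 := by
  have h0 := zero_le_add_iff_of_far (t := 0) hJ (by simp)
  have h1 := zero_le_add_iff_of_far hJ hs
  have h2 := zero_le_add_iff_of_far (t := -s) hJ (by rwa [abs_neg])
  rw [add_zero] at h0
  simp only [trapezoidWeight, heaviside, h0, h1, h2]
  split_ifs <;> norm_num

/-- The facet `v i ⬝ x = c i` of `K`. -/
def facet (K : Set (Fin n → ℝ)) (v : ι → Fin n → ℤ) (c : ι → ℤ) (i : ι) : Set (Fin n → ℝ) :=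
  {x ∈ K | pairing (v i) x = c i}

theorem facet_subset (i : ι) : facet K v c i ⊆ K := fun _ hx => hx.1

theorem scaled_mem_facet_iff {k : ℕ} (hk : 1 ≤ k) {z : Fin n → ℤ} {d : Fin n → ℝ} {i : ι} :
    (k : ℝ)⁻¹ • (toReal z + d) ∈ facet K v c i ↔ (k : ℝ)⁻¹ • (toReal z + d) ∈ K ∧
      (level (v i) (c i) k z : ℝ) + pairing (v i) d = 0 :=
  and_congr_right fun _ => pairing_scaled_eq_iff hk

/-- Uniform constants: `N₁` bounds the displacements in the unit cube as seen by the facet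
functionals, `N` bounds all displacements that are used, and `D` bounds their norms. The vectors
`e i` are transversal to the facets. -/
structure DisplacementBounds (v e : ι → Fin n → ℤ) (N₁ N D : ℕ) : Prop where
  dotProduct_eq_one : ∀ i, v i ⬝ᵥ e i = 1
  cube : ∀ i, ∀ u ∈ unitCube n, |pairing (v i) u| ≤ N₁
  transversal : ∀ i j, (N₁ : ℝ) * |pairing (v j) (toReal (e i))| ≤ N
  normal : ∀ i j, (N₁ : ℝ) + |pairing (v j) (toReal (v i))| ≤ N
  le : N₁ ≤ N
  norm_transversal : ∀ i, (N₁ : ℝ) * ‖toReal (e i)‖ ≤ D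
  norm_normal : ∀ i, 1 + ‖toReal (v i)‖ ≤ D
  one_le : 1 ≤ D

theorem exists_nat_forall_le [Finite ι] (f : ι → ℝ) : ∃ N : ℕ, ∀ i, f i ≤ N := by
  obtain ⟨b, hb⟩ := (Set.finite_range f).bddAbove
  obtain ⟨N, hN⟩ := exists_nat_ge b
  exact ⟨N, fun i => (hb ⟨i, rfl⟩).trans hN⟩

theorem abs_pairing_le_of_mem_unitCube (v : Fin n → ℤ) {u : Fin n → ℝ} (hu : u ∈ unitCube n) :
    |pairing v u| ≤ ∑ a, |(v a : ℝ)| := by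
  rw [pairing_apply, dotProduct]
  refine (Finset.abs_sum_le_sum_abs _ _).trans (Finset.sum_le_sum fun a _ => ?_)
  rw [abs_mul]
  exact mul_le_of_le_one_right (abs_nonneg _) (abs_le_one_of_mem_unitCube hu a)

theorem IsFacetSystem.exists_displacementBounds [Finite ι] (hF : IsFacetSystem K v c) :
    ∃ (e : ι → Fin n → ℤ) (N₁ N D : ℕ), DisplacementBounds v e N₁ N D := by
  choose e he using fun i => exists_dotProduct_eq_one (hF.gcd_eq_one i)
  obtain ⟨N₁, hN₁⟩ := exists_nat_forall_le fun i => ∑ a, |(v i a : ℝ)|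
  obtain ⟨A, hA⟩ := exists_nat_forall_le fun p : ι × ι =>
    (N₁ : ℝ) * |pairing (v p.2) (toReal (e p.1))|
  obtain ⟨A', hA'⟩ := exists_nat_forall_le fun p : ι × ι =>
    (N₁ : ℝ) + |pairing (v p.2) (toReal (v p.1))|
  obtain ⟨D, hD⟩ := exists_nat_forall_le fun i => (N₁ : ℝ) * ‖toReal (e i)‖
  obtain ⟨D', hD'⟩ := exists_nat_forall_le fun i => 1 + ‖toReal (v i)‖
  refine ⟨e, N₁, A + A' + N₁, D + D' + 1, he, fun i u hu =>
    (abs_pairing_le_of_mem_unitCube _ hu).trans (hN₁ i), fun i j => (hA (i, j)).trans ?_,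
    fun i j => (hA' (i, j)).trans ?_, by omega, fun i => (hD i).trans ?_,
    fun i => (hD' i).trans ?_, by omega⟩
  · exact_mod_cast (by omega : A ≤ A + A' + N₁)
  · exact_mod_cast (by omega : A' ≤ A + A' + N₁)
  · exact_mod_cast (by omega : D ≤ D + D' + 1)
  · exact_mod_cast (by omega : D' ≤ D + D' + 1)

variable {e : ι → Fin n → ℤ} {N₁ N D : ℕ}

theorem toReal_zero : toReal (0 : Fin n → ℤ) = 0 := by ext; simp [toReal]

theorem toReal_smul (m : ℤ) (w : Fin n → ℤ) : toReal (m • w) = (m : ℝ) • toReal w := by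
  ext i; simp [toReal]

theorem DisplacementBounds.pairing_transversal (hb : DisplacementBounds v e N₁ N D) (i : ι)
    (J : ℤ) : pairing (v i) (toReal (-J • e i)) = -J := by
  rw [pairing_toReal, dotProduct_smul, hb.dotProduct_eq_one]; simp

theorem DisplacementBounds.abs_pairing_transversal_le (hb : DisplacementBounds v e N₁ N D)
    (i j : ι) {J : ℤ} (hJ : |J| ≤ N₁) : |pairing (v j) (toReal (-J • e i))| ≤ N := by
  rw [toReal_smul, map_smul, smul_eq_mul, abs_mul]
  have h1 : |((-J : ℤ) : ℝ)| ≤ N₁ := by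
    rw [Int.cast_neg, abs_neg]; exact_mod_cast hJ
  exact (mul_le_mul_of_nonneg_right h1 (abs_nonneg _)).trans (hb.transversal i j)

theorem DisplacementBounds.norm_transversal_le (hb : DisplacementBounds v e N₁ N D)
    (i : ι) {J : ℤ} (hJ : |J| ≤ N₁) : ‖toReal (-J • e i)‖ ≤ D := by
  rw [toReal_smul, norm_smul, Real.norm_eq_abs]
  have h1 : |((-J : ℤ) : ℝ)| ≤ N₁ := by
    rw [Int.cast_neg, abs_neg]; exact_mod_cast hJ
  exact (mul_le_mul_of_nonneg_right h1 (norm_nonneg _)).trans (hb.norm_transversal i)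

theorem DisplacementBounds.abs_pairing_le (hb : DisplacementBounds v e N₁ N D) {u : Fin n → ℝ}
    (hu : u ∈ unitCube n) (j : ι) : |pairing (v j) u| ≤ N :=
  (hb.cube j u hu).trans (by exact_mod_cast hb.le)

theorem norm_le_one_of_mem_unitCube {u : Fin n → ℝ} (hu : u ∈ unitCube n) : ‖u‖ ≤ 1 :=
  (pi_norm_le_iff_of_nonneg zero_le_one).2 fun i => abs_le_one_of_mem_unitCube hu i

/-- The term at `z` of the lattice sum that compares the sum of `h` over the lattice points of the
polytope with the average of the sums displaced by `u` and `-u` and with the facet sums. The facet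
sums are distributed over the levels near the facets by translating along `e i`. -/
noncomputable def trapezoidDefect [Fintype ι] (K : Set (Fin n → ℝ)) (v e : ι → Fin n → ℤ)
    (c : ι → ℤ) (h : (Fin n → ℝ) → ℝ) (N₁ k : ℕ) (u : Fin n → ℝ) (z : Fin n → ℤ) : ℝ :=
  K.indicator h ((k : ℝ)⁻¹ • (toReal z + toReal 0)) -
    1 / 2 * K.indicator h ((k : ℝ)⁻¹ • (toReal z + u)) -
    1 / 2 * K.indicator h ((k : ℝ)⁻¹ • (toReal z + -u)) -
    ∑ i, ∑ J ∈ Finset.Icc (-(N₁ : ℤ)) N₁, trapezoidWeight (pairing (v i) u) J *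
      (facet K v c i).indicator h ((k : ℝ)⁻¹ • (toReal z + toReal (-J • e i)))

theorem abs_three_sub_le {a b b' t : ℝ} (ha : |a| ≤ t) (hb : |b| ≤ t) (hb' : |b'| ≤ t) :
    |a - 1 / 2 * b - 1 / 2 * b'| ≤ 2 * t := by
  rw [abs_le] at *
  constructor <;> linarith [ha.1, ha.2, hb.1, hb.2, hb'.1, hb'.2]

theorem abs_trapezoidDefect_le [Fintype ι] (hh : HasSecondOrderBound K h M) (hne : K.Nonempty)
    (k : ℕ) (u : Fin n → ℝ) (z : Fin n → ℤ) : |trapezoidDefect K v e c h N₁ k u z| ≤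
      2 * M + Fintype.card ι * ((2 * N₁ + 1) * M) := by
  have h1 := abs_three_sub_le
    (hh.abs_indicator_le hne subset_rfl ((k : ℝ)⁻¹ • (toReal z + toReal 0)))
    (hh.abs_indicator_le hne subset_rfl ((k : ℝ)⁻¹ • (toReal z + u)))
    (hh.abs_indicator_le hne subset_rfl ((k : ℝ)⁻¹ • (toReal z + -u)))
  refine (abs_sub _ _).trans (add_le_add h1 ?_)
  refine (Finset.abs_sum_le_sum_abs _ _).trans
    ((Finset.sum_le_card_nsmul _ _ ((2 * N₁ + 1) * M) fun i _ => ?_).trans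
      (by rw [nsmul_eq_mul, Finset.card_univ]))
  refine (Finset.abs_sum_le_sum_abs _ _).trans
    ((Finset.sum_le_card_nsmul _ _ M fun J _ => ?_).trans (le_of_eq ?_))
  · rw [abs_mul]
    exact (mul_le_of_le_one_left (abs_nonneg _) (abs_trapezoidWeight_le _ _)).trans
      (hh.abs_indicator_le hne (facet_subset i) _)
  · rw [nsmul_eq_mul]
    congr 1
    have h2 : (Finset.Icc (-(N₁ : ℤ)) N₁).card = 2 * N₁ + 1 := by
      rw [Int.card_Icc]; omega
    rw [h2]; push_cast; ring

theorem DisplacementBounds.facet_indicator_eq_zero (hb : DisplacementBounds v e N₁ N D) {k : ℕ}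
    (hk : 1 ≤ k) {i : ι} {z : Fin n → ℤ} {J : ℤ} (hJ : level (v i) (c i) k z ≠ J) :
    (facet K v c i).indicator h ((k : ℝ)⁻¹ • (toReal z + toReal (-J • e i))) = 0 := by
  refine Set.indicator_of_notMem (fun hmem => hJ ?_) _
  have h1 := ((scaled_mem_facet_iff hk).1 hmem).2
  rw [hb.pairing_transversal] at h1
  have h2 : (level (v i) (c i) k z : ℝ) = J := by linarith
  exact_mod_cast h2

theorem DisplacementBounds.facet_sum_eq_zero (hb : DisplacementBounds v e N₁ N D) {k : ℕ}
    (hk : 1 ≤ k) {i : ι} {z : Fin n → ℤ} (hz : (N₁ : ℤ) < |level (v i) (c i) k z|)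
    (u : Fin n → ℝ) :
    ∑ J ∈ Finset.Icc (-(N₁ : ℤ)) N₁, trapezoidWeight (pairing (v i) u) J *
      (facet K v c i).indicator h ((k : ℝ)⁻¹ • (toReal z + toReal (-J • e i))) = 0 := by
  refine Finset.sum_eq_zero fun J hJ => ?_
  rw [hb.facet_indicator_eq_zero hk, mul_zero]
  rintro rfl
  rw [Finset.mem_Icc, ← abs_le] at hJ
  omega

/-- Away from all facets the defect is a second difference of `h`, or zero. -/
theorem IsFacetSystem.abs_trapezoidDefect_le_of_far [Fintype ι] (hF : IsFacetSystem K v c)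
    (hb : DisplacementBounds v e N₁ N D) (hh : HasSecondOrderBound K h M) (hne : K.Nonempty)
    {k : ℕ} (hk : 1 ≤ k) {u : Fin n → ℝ} (hu : u ∈ unitCube n) {z : Fin n → ℤ}
    (hz : ∀ j, (N : ℤ) < |level (v j) (c j) k z|) :
    |trapezoidDefect K v e c h N₁ k u z| ≤ M / (k : ℝ) ^ 2 := by
  have hM := hh.nonneg hne
  have hsum := Finset.sum_eq_zero fun i (_ : i ∈ Finset.univ) =>
    hb.facet_sum_eq_zero (K := K) (h := h) hk (i := i) (z := z)
      (lt_of_le_of_lt (by exact_mod_cast hb.le) (hz i)) u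
  have h0 := hF.scaled_mem_iff_of_far hk hz (d := toReal 0) fun j => by
    rw [pairing_toReal]; simp
  have h1 := hF.scaled_mem_iff_of_far hk hz (hb.abs_pairing_le hu)
  have h2 := hF.scaled_mem_iff_of_far hk hz (d := -u) fun j => by
    rw [map_neg, abs_neg]; exact hb.abs_pairing_le hu j
  rw [trapezoidDefect, hsum, sub_zero]
  by_cases hpos : ∀ j, 0 < level (v j) (c j) k z
  · rw [Set.indicator_of_mem (h0.2 hpos), Set.indicator_of_mem (h1.2 hpos),
      Set.indicator_of_mem (h2.2 hpos)]
    have hx : ∀ d : Fin n → ℝ, (k : ℝ)⁻¹ • (toReal z + d) =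
        (k : ℝ)⁻¹ • (toReal z + toReal 0) + (k : ℝ)⁻¹ • d := fun d => by
      rw [toReal_zero, add_zero, smul_add]
    have h3 := hh.abs_second_difference_le ((k : ℝ)⁻¹ • (toReal z + toReal 0)) ((k : ℝ)⁻¹ • u)
      (h0.2 hpos) (by rw [← hx]; exact h1.2 hpos)
      (by rw [← smul_neg, ← hx]; exact h2.2 hpos)
    rw [← smul_neg, ← hx, ← hx] at h3
    refine h3.trans ?_
    rw [norm_smul, norm_inv, Real.norm_natCast, mul_pow, inv_pow, div_eq_mul_inv]
    refine mul_le_mul_of_nonneg_left (mul_le_of_le_one_right (by positivity) ?_) hM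
    exact pow_le_one₀ (norm_nonneg _) (norm_le_one_of_mem_unitCube hu)
  · rw [Set.indicator_of_notMem fun hm => hpos (h0.1 hm),
      Set.indicator_of_notMem fun hm => hpos (h1.1 hm),
      Set.indicator_of_notMem fun hm => hpos (h2.1 hm)]
    simp only [mul_zero, sub_zero, abs_zero]
    positivity

/-- Near one facet only, `h` may be replaced by a nearby constant value on the polytope. -/
theorem IsFacetSystem.abs_indicator_sub_heaviside_le (hF : IsFacetSystem K v c)
    (hh : HasSecondOrderBound K h M) (hne : K.Nonempty) {k : ℕ} (hk : 1 ≤ k) {z : Fin n → ℤ}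
    {i : ι} (hz : ∀ j, j ≠ i → (N : ℤ) < |level (v j) (c j) k z|)
    (hpos : ∀ j, j ≠ i → 0 < level (v j) (c j) k z) {d d₀ : Fin n → ℝ}
    (hd : ∀ j, |pairing (v j) d| ≤ N) (hdn : ‖d‖ ≤ D) (hdn₀ : ‖d₀‖ ≤ D)
    (hd₀ : (k : ℝ)⁻¹ • (toReal z + d₀) ∈ K) :
    |K.indicator h ((k : ℝ)⁻¹ • (toReal z + d)) -
      heaviside (level (v i) (c i) k z + pairing (v i) d) *
        h ((k : ℝ)⁻¹ • (toReal z + d₀))| ≤ 2 * M * D / k := by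
  have hM := hh.nonneg hne
  have hiff := hF.scaled_mem_iff_of_far_except hk hz hd
  by_cases hs : 0 ≤ (level (v i) (c i) k z : ℝ) + pairing (v i) d
  · have hmem := hiff.2 ⟨hpos, hs⟩
    rw [Set.indicator_of_mem hmem, heaviside, if_pos hs, one_mul]
    exact hh.abs_scaled_sub_le hne hmem hd₀ hdn hdn₀
  · rw [Set.indicator_of_notMem fun hm => hs (hiff.1 hm).2, heaviside, if_neg hs]
    simp only [zero_mul, sub_zero, abs_zero]
    positivity

/-- Near the facet `i` only, all values of `h` agree up to `O(1 / k)`, and the coefficients of the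
defect cancel by the choice of `trapezoidWeight`. -/
theorem IsFacetSystem.abs_trapezoidDefect_le_of_far_except [Fintype ι] (hF : IsFacetSystem K v c)
    (hb : DisplacementBounds v e N₁ N D) (hh : HasSecondOrderBound K h M) (hne : K.Nonempty)
    {k : ℕ} (hk : 1 ≤ k) {u : Fin n → ℝ} (hu : u ∈ unitCube n) {z : Fin n → ℤ} {i : ι}
    (hz : ∀ j, j ≠ i → (N : ℤ) < |level (v j) (c j) k z|) :
    |trapezoidDefect K v e c h N₁ k u z| ≤ 4 * M * D / k := by
  have hM := hh.nonneg hne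
  have hsum : ∑ j, ∑ J ∈ Finset.Icc (-(N₁ : ℤ)) N₁, trapezoidWeight (pairing (v j) u) J *
      (facet K v c j).indicator h ((k : ℝ)⁻¹ • (toReal z + toReal (-J • e j))) =
      ∑ J ∈ Finset.Icc (-(N₁ : ℤ)) N₁, trapezoidWeight (pairing (v i) u) J *
      (facet K v c i).indicator h ((k : ℝ)⁻¹ • (toReal z + toReal (-J • e i))) :=
    Finset.sum_eq_single i (fun j _ hj => hb.facet_sum_eq_zero hk
      (lt_of_le_of_lt (by exact_mod_cast hb.le) (hz j hj)) u) (by simp)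
  rw [trapezoidDefect, hsum]
  have hd0 : ∀ j, |pairing (v j) (toReal (0 : Fin n → ℤ))| ≤ N := fun j => by
    rw [pairing_toReal]; simp
  have hd1 := hb.abs_pairing_le hu
  have hd2 : ∀ j, |pairing (v j) (-u)| ≤ N := fun j => by
    rw [map_neg, abs_neg]; exact hb.abs_pairing_le hu j
  have h0 := hF.scaled_mem_iff_of_far_except hk hz hd0
  have h1 := hF.scaled_mem_iff_of_far_except hk hz hd1
  have h2 := hF.scaled_mem_iff_of_far_except hk hz hd2
  have hJJ : ∀ {J : ℤ}, |J| ≤ N₁ → _ := fun hJ => hF.scaled_mem_iff_of_far_except hk hz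
    (fun j => hb.abs_pairing_transversal_le i j hJ)
  by_cases hpos : ∀ j, j ≠ i → 0 < level (v j) (c j) k z
  · -- The values of `h` are compared with its value at a point of the polytope near `z`.
    have main : ∀ d₀ : Fin n → ℝ, ‖d₀‖ ≤ D → (k : ℝ)⁻¹ • (toReal z + d₀) ∈ K →
        |K.indicator h ((k : ℝ)⁻¹ • (toReal z + toReal 0)) -
          1 / 2 * K.indicator h ((k : ℝ)⁻¹ • (toReal z + u)) -
          1 / 2 * K.indicator h ((k : ℝ)⁻¹ • (toReal z + -u)) -
          trapezoidWeight (pairing (v i) u) (level (v i) (c i) k z) *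
            h ((k : ℝ)⁻¹ • (toReal z + d₀))| ≤ 4 * M * D / k := by
      intro d₀ hdn hd₀
      have hD : (1 : ℝ) ≤ D := by exact_mod_cast hb.one_le
      have hn0 : ‖toReal (0 : Fin n → ℤ)‖ ≤ D := by
        rw [toReal_zero, norm_zero]; positivity
      have hn1 : ‖u‖ ≤ D := (norm_le_one_of_mem_unitCube hu).trans hD
      have b0 := hF.abs_indicator_sub_heaviside_le hh hne hk hz hpos hd0 hn0 hdn hd₀
      have b1 := hF.abs_indicator_sub_heaviside_le hh hne hk hz hpos hd1 hn1 hdn hd₀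
      have b2 := hF.abs_indicator_sub_heaviside_le hh hne hk hz hpos hd2
        (by rwa [norm_neg]) hdn hd₀
      have h3 := abs_three_sub_le b0 b1 b2
      have h4 : pairing (v i) (toReal (0 : Fin n → ℤ)) = 0 := by rw [pairing_toReal]; simp
      rw [h4, add_zero, map_neg] at h3
      convert h3 using 1
      · rw [trapezoidWeight]; congr 1; ring
      · ring
    by_cases hJ : |level (v i) (c i) k z| ≤ N₁
    -- The only surviving translate of the facet sum is the one that brings `z` onto the facet.
    · have hmem : (k : ℝ)⁻¹ • (toReal z + toReal (-level (v i) (c i) k z • e i)) ∈ K := by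
        rw [hJJ hJ]
        refine ⟨hpos, ?_⟩
        rw [hb.pairing_transversal]; simp
      have hmem' : (k : ℝ)⁻¹ • (toReal z + toReal (-level (v i) (c i) k z • e i)) ∈
          facet K v c i := by
        rw [scaled_mem_facet_iff hk]
        refine ⟨hmem, ?_⟩
        rw [hb.pairing_transversal]; simp
      rw [Finset.sum_eq_single (level (v i) (c i) k z), Set.indicator_of_mem hmem']
      · exact main _ (hb.norm_transversal_le i hJ) hmem
      · intro J _ hne'
        rw [hb.facet_indicator_eq_zero hk hne'.symm, mul_zero]
      · intro hnot
        rw [Finset.mem_Icc, ← abs_le] at hnot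
        exact absurd hJ hnot
    -- Beyond the level `N₁` the displacements by `u` and `-u` do not cross the facet.
    · push Not at hJ
      rw [hb.facet_sum_eq_zero hk hJ, sub_zero]
      have hw := trapezoidWeight_eq_zero (hb.cube i u hu) hJ
      by_cases hsgn : 0 < level (v i) (c i) k z
      · have hmem : (k : ℝ)⁻¹ • (toReal z + toReal 0) ∈ K := by
          rw [h0, pairing_toReal]
          refine ⟨hpos, ?_⟩
          have : (0 : ℝ) < level (v i) (c i) k z := by exact_mod_cast hsgn
          simpa using this.le
        have h3 := main (toReal 0) (by
          rw [toReal_zero, norm_zero]; positivity) hmem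
        rwa [hw, zero_mul, sub_zero] at h3
      · have s0 := zero_le_add_iff_of_far (t := pairing (v i) (toReal 0)) hJ (by
          rw [pairing_toReal]; simp)
        have s1 := zero_le_add_iff_of_far hJ (hb.cube i u hu)
        have s2 := zero_le_add_iff_of_far (t := pairing (v i) (-u)) hJ (by
          rw [map_neg, abs_neg]; exact hb.cube i u hu)
        rw [Set.indicator_of_notMem fun hm => hsgn (s0.1 (h0.1 hm).2),
          Set.indicator_of_notMem fun hm => hsgn (s1.1 (h1.1 hm).2),
          Set.indicator_of_notMem fun hm => hsgn (s2.1 (h2.1 hm).2)]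
        simp only [mul_zero, sub_zero, abs_zero]
        positivity
  · have hzero : ∑ J ∈ Finset.Icc (-(N₁ : ℤ)) N₁, trapezoidWeight (pairing (v i) u) J *
        (facet K v c i).indicator h ((k : ℝ)⁻¹ • (toReal z + toReal (-J • e i))) = 0 := by
      refine Finset.sum_eq_zero fun J hJ => ?_
      rw [Finset.mem_Icc, ← abs_le] at hJ
      rw [Set.indicator_of_notMem fun hm => hpos ((hJJ hJ).1 (facet_subset i hm)).1, mul_zero]
    rw [hzero, Set.indicator_of_notMem fun hm => hpos (h0.1 hm).1,
      Set.indicator_of_notMem fun hm => hpos (h1.1 hm).1,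
      Set.indicator_of_notMem fun hm => hpos (h2.1 hm).1]
    simp only [mul_zero, sub_zero, abs_zero]
    positivity

/-! ### The trapezoidal sum over a polytope -/

theorem integrable_indicator_of_isCompact (hK : IsCompact K) (hcont : ContinuousOn h K) :
    Integrable (K.indicator h) :=
  (integrable_indicator_iff hK.measurableSet).2 (hcont.integrableOn_compact hK)

theorem abs_setIntegral_unitCube_le {g : (Fin n → ℝ) → ℝ} {E : ℝ}
    (hg : ∀ᵐ u : Fin n → ℝ, u ∈ unitCube n → |g u| ≤ E) : |∫ u in unitCube n, g u| ≤ E := by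
  have h1 := norm_setIntegral_le_of_norm_le_const_ae' (μ := volume) (s := unitCube n) (f := g)
    (C := E) (by rw [volume_unitCube]; exact ENNReal.one_lt_top) hg
  rw [Measure.real, volume_unitCube] at h1
  simpa using h1

theorem setIntegral_unitCube_const (a : ℝ) : ∫ _ in unitCube n, a = a := by
  rw [setIntegral_const, Measure.real, volume_unitCube]
  simp

theorem integrableOn_unitCube_const (a : ℝ) : IntegrableOn (fun _ => a) (unitCube n) :=
  integrableOn_const (by rw [volume_unitCube]; exact ENNReal.one_ne_top) enorm_ne_top

theorem ae_pairing_ne_int [Countable ι] (hv : ∀ i, v i ≠ 0) :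
    ∀ᵐ u : Fin n → ℝ, ∀ i, ∀ m : ℤ, pairing (v i) u ≠ m := by
  refine ae_all_iff.2 fun i => ae_all_iff.2 fun m => ?_
  rw [ae_iff]
  simpa using volume_pairing_eq (hv i) m

theorem DisplacementBounds.abs_toReal_le (hb : DisplacementBounds v e N₁ N D) (i : ι) {J : ℤ}
    (hJ : |J| ≤ N₁) (a : Fin n) : |(-J • e i) a| ≤ D := by
  have h1 := (norm_le_pi_norm (toReal (-J • e i)) a).trans (hb.norm_transversal_le i hJ)
  simp only [toReal, Real.norm_eq_abs] at h1
  exact_mod_cast h1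

/-- The lattice sum over the polytope is given up to `O(k ^ (n - 2))` by the integral and half of
the lattice sums over the facets. -/
theorem IsFacetSystem.exists_abs_trapezoid_le [Fintype ι] (hF : IsFacetSystem K v c)
    (hh : HasSecondOrderBound K h M) (hK : IsCompact K) (hne : K.Nonempty)
    (hcont : ContinuousOn h K) : ∃ C : ℝ, ∀ᶠ k : ℕ in atTop,
      |∑ᶠ z : Fin n → ℤ, K.indicator h ((k : ℝ)⁻¹ • toReal z) - (k : ℝ) ^ n * (∫ x in K, h x) -
        1 / 2 * ∑ i, ∑ᶠ z : Fin n → ℤ, (facet K v c i).indicator h ((k : ℝ)⁻¹ • toReal z)| *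
        (k : ℝ) ^ 2 ≤ C * (k : ℝ) ^ n := by
  obtain ⟨e, N₁, N, D, hb⟩ := hF.exists_displacementBounds
  obtain ⟨ρ, hρ⟩ := hK.isBounded.exists_norm_le
  have hM := hh.nonneg hne
  obtain ⟨R₀, hR₀⟩ := exists_nat_ge (ρ + D)
  obtain ⟨R, hR, hR1⟩ : ∃ R : ℕ, ρ + D ≤ R ∧ 1 ≤ R :=
    ⟨R₀ + 1, by push_cast; linarith, by omega⟩
  have hsupp : ∀ x, K.indicator h x ≠ 0 → ‖x‖ ≤ ρ := fun x hx =>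
    hρ x (Set.mem_of_indicator_ne_zero hx)
  have hsuppF : ∀ i x, (facet K v c i).indicator h x ≠ 0 → ‖x‖ ≤ ρ := fun i x hx =>
    hρ x (facet_subset i (Set.mem_of_indicator_ne_zero hx))
  have hD1 : (1 : ℝ) ≤ D := by exact_mod_cast hb.one_le
  set B : ℝ := 2 * M + Fintype.card ι * ((2 * N₁ + 1) * M) + 4 * M * D + M with hB
  obtain ⟨C, hC⟩ := hF.exists_abs_sum_le hR1 N B
  refine ⟨C, ?_⟩
  filter_upwards [hC, eventually_ge_atTop 1] with k hCk hk
  have hk' : (0 : ℝ) < k := by exact_mod_cast hk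
  have hk2 : (0 : ℝ) < (k : ℝ) ^ 2 := by positivity
  obtain ⟨hi1, he1⟩ := pow_mul_integral_eq (integrable_indicator_of_isCompact hK hcont) hsupp hk
    (R := R) (by linarith)
  obtain ⟨hi2, he2⟩ := pow_mul_integral_eq_sub (integrable_indicator_of_isCompact hK hcont) hsupp
    hk (R := R) (by linarith)
  rw [integral_indicator hK.measurableSet] at he1 he2
  set S := ∑ᶠ z : Fin n → ℤ, K.indicator h ((k : ℝ)⁻¹ • toReal z) with hS
  set T : ι → ℝ := fun i => ∑ᶠ z : Fin n → ℤ, (facet K v c i).indicator h ((k : ℝ)⁻¹ • toReal z)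
    with hT
  set A₁ : (Fin n → ℝ) → ℝ := fun u =>
    ∑ z ∈ latticeBox n (R * k), K.indicator h ((k : ℝ)⁻¹ • (toReal z + u)) with hA₁
  set A₂ : (Fin n → ℝ) → ℝ := fun u =>
    ∑ z ∈ latticeBox n (R * k), K.indicator h ((k : ℝ)⁻¹ • (toReal z + -u)) with hA₂
  have hint : S - (k : ℝ) ^ n * (∫ x in K, h x) - 1 / 2 * ∑ i, T i =
      ∫ u in unitCube n, ((S - 1 / 2 * ∑ i, T i) - (1 / 2 * A₁ u + 1 / 2 * A₂ u)) := by
    have hi3 : IntegrableOn (fun u => 1 / 2 * A₁ u + 1 / 2 * A₂ u) (unitCube n) :=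
      (hi1.const_mul _).add (hi2.const_mul _)
    rw [integral_sub (integrableOn_unitCube_const _) hi3, setIntegral_unitCube_const,
      integral_add (hi1.const_mul _) (hi2.const_mul _), integral_const_mul, integral_const_mul,
      ← he1, ← he2]
    ring
  rw [← le_div_iff₀ hk2, hint]
  refine abs_setIntegral_unitCube_le ?_
  filter_upwards [ae_pairing_ne_int fun i => ne_zero_of_gcd_eq_one (hF.gcd_eq_one i)]
    with u hu hucube
  have hsum : (S - 1 / 2 * ∑ i, T i) - (1 / 2 * A₁ u + 1 / 2 * A₂ u) =
      ∑ z ∈ latticeBox n (R * k), trapezoidDefect K v e c h N₁ k u z := by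
    simp only [trapezoidDefect, Finset.sum_sub_distrib, ← Finset.mul_sum]
    rw [sum_latticeBox_add hsupp hk hR (by simp), Finset.sum_comm]
    have h1 : ∀ i, ∑ z ∈ latticeBox n (R * k), ∑ J ∈ Finset.Icc (-(N₁ : ℤ)) N₁,
        trapezoidWeight (pairing (v i) u) J *
          (facet K v c i).indicator h ((k : ℝ)⁻¹ • (toReal z + toReal (-J • e i))) =
        1 / 2 * T i := fun i => by
      rw [Finset.sum_comm, ← sum_trapezoidWeight (hb.cube i u hucube) (hu i), Finset.sum_mul]
      refine Finset.sum_congr rfl fun J hJ => ?_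
      rw [Finset.mem_Icc, ← abs_le] at hJ
      rw [← Finset.mul_sum, sum_latticeBox_add (hsuppF i) hk hR (hb.abs_toReal_le i hJ)]
    rw [Finset.sum_congr rfl fun i _ => h1 i, ← Finset.mul_sum]
    ring
  rw [hsum, le_div_iff₀ hk2]
  have hBM : 0 ≤ Fintype.card ι * ((2 * N₁ + 1) * M) := by positivity
  have hBD : 0 ≤ 4 * M * D := by positivity
  refine hCk _ (fun z => ?_) (fun z i hz => ?_) fun z hz => ?_
  · exact (abs_trapezoidDefect_le hh hne k u z).trans (by linarith)
  · exact (hF.abs_trapezoidDefect_le_of_far_except hb hh hne hk hucube hz).trans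
      (div_le_div_of_nonneg_right (by linarith) hk'.le)
  · exact (hF.abs_trapezoidDefect_le_of_far hb hh hne hk hucube hz).trans
      (div_le_div_of_nonneg_right (by linarith) hk2.le)

/-! ### Lattice sums over facets -/

/-- The extension of `h` from the facet `i` to the slab `0 ≤ k * l < 1`, constant along the
normal. -/
noncomputable def slabExtension (K : Set (Fin n → ℝ)) (v : ι → Fin n → ℤ) (c : ι → ℤ)
    (h : (Fin n → ℝ) → ℝ) (i : ι) (k : ℕ) : (Fin n → ℝ) → ℝ :=
  {x | 0 ≤ k * facetFun K (v i) x ∧ k * facetFun K (v i) x < 1}.indicator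
    fun x => (facet K v c i).indicator h (facetProj K (v i) x)

theorem norm_le_of_facetProj_mem {ρ : ℝ} (hρ : ∀ x ∈ K, ‖x‖ ≤ ρ) {w : Fin n → ℤ} (hw : w ≠ 0)
    {x : Fin n → ℝ} (h0 : 0 ≤ facetFun K w x) (h1 : facetFun K w x ≤ 1)
    (hx : facetProj K w x ∈ K) : ‖x‖ ≤ ρ + ‖toReal w‖ := by
  have hpos := one_le_pairing_self hw
  have heq : x = facetProj K w x + (facetFun K w x / (toReal w ⬝ᵥ toReal w)) • toReal w := by
    rw [facetProj, sub_add_cancel]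
  rw [heq]
  refine (norm_add_le _ _).trans (add_le_add (hρ _ hx) ?_)
  rw [norm_smul, Real.norm_eq_abs]
  refine mul_le_of_le_one_left (norm_nonneg _) ?_
  rw [← pairing_apply, abs_of_nonneg (by positivity), div_le_one (by linarith)]
  linarith

theorem isCompact_facet (hK : IsCompact K) (i : ι) : IsCompact (facet K v c i) :=
  hK.inter_right (isClosed_eq (continuous_pairing (v i)) continuous_const)

theorem integrableOn_slab (hK : IsCompact K) (hcont : ContinuousOn h K) {i : ι}
    (hv : v i ≠ 0) :
    IntegrableOn (fun x => (facet K v c i).indicator h (facetProj K (v i) x))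
      {x | 0 ≤ facetFun K (v i) x ∧ facetFun K (v i) x ≤ 1} := by
  obtain ⟨ρ, hρ⟩ := hK.isBounded.exists_norm_le
  have hproj := continuous_facetProj K (v i)
  have hfun := continuous_facetFun K (v i)
  have hT : IsClosed (facetProj K (v i) ⁻¹' facet K v c i) :=
    (isCompact_facet hK i).isClosed.preimage hproj
  have hS : IsClosed {x | 0 ≤ facetFun K (v i) x ∧ facetFun K (v i) x ≤ 1} :=
    (isClosed_le continuous_const hfun).inter (isClosed_le hfun continuous_const)
  have hcomp : IsCompact ({x | 0 ≤ facetFun K (v i) x ∧ facetFun K (v i) x ≤ 1} ∩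
      facetProj K (v i) ⁻¹' facet K v c i) := by
    refine Metric.isCompact_of_isClosed_isBounded (hS.inter hT)
      (isBounded_iff_forall_norm_le.2 ⟨ρ + ‖toReal (v i)‖, ?_⟩)
    rintro x ⟨⟨h0, h1⟩, hx⟩
    exact norm_le_of_facetProj_mem hρ hv h0 h1 (facet_subset i hx)
  have hind : (fun x => (facet K v c i).indicator h (facetProj K (v i) x)) =
      (facetProj K (v i) ⁻¹' facet K v c i).indicator (h ∘ facetProj K (v i)) := by
    ext x; rfl
  rw [hind, IntegrableOn, integrable_indicator_iff hT.measurableSet, IntegrableOn,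
    Measure.restrict_restrict hT.measurableSet, Set.inter_comm]
  exact (hcont.comp hproj.continuousOn fun x hx => facet_subset i hx.2).integrableOn_compact hcomp

theorem measurableSet_slab (w : Fin n → ℤ) (k : ℕ) :
    MeasurableSet {x | 0 ≤ k * facetFun K w x ∧ k * facetFun K w x < 1} := by
  have hfun := (continuous_facetFun K w).measurable.const_mul (k : ℝ)
  exact (measurableSet_le measurable_const hfun).inter (measurableSet_lt hfun measurable_const)

theorem integrable_slabExtension (hK : IsCompact K) (hcont : ContinuousOn h K) {i : ι}
    (hv : v i ≠ 0) {k : ℕ} (hk : 1 ≤ k) : Integrable (slabExtension K v c h i k) := by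
  have hk' : (1 : ℝ) ≤ k := by exact_mod_cast hk
  rw [slabExtension, integrable_indicator_iff (measurableSet_slab _ k)]
  refine (integrableOn_slab hK hcont hv).mono_set ?_
  rintro x ⟨h0, h1⟩
  have h2 : 0 ≤ facetFun K (v i) x := nonneg_of_mul_nonneg_right h0 (by linarith)
  exact ⟨h2, by nlinarith⟩

/-- The integral over the thin slab, multiplied by `k`, is the integral over the facet; it does not
depend on `k`. -/
theorem mul_integral_slabExtension (hK : IsCompact K) (hcont : ContinuousOn h K) {i : ι}
    (hv : v i ≠ 0) {k : ℕ} (hk : 1 ≤ k) :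
    k * ∫ x, slabExtension K v c h i k x =
      ∫ x in {x | 0 ≤ facetFun K (v i) x ∧ facetFun K (v i) x ≤ 1},
        (facet K v c i).indicator h (facetProj K (v i) x) := by
  rw [setIntegral_slab hv (integrableOn_slab hK hcont hv) hk, slabExtension,
    integral_indicator (measurableSet_slab _ k)]

/-- The term at `z` of the comparison of the lattice sum over a facet, translated to the one lattice
level that the displacement `u` moves into the slab `0 ≤ k * l < 1`, with the displaced lattice sum
over the slab. -/
noncomputable def facetDefect (K : Set (Fin n → ℝ)) (v e : ι → Fin n → ℤ) (c : ι → ℤ)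
    (h : (Fin n → ℝ) → ℝ) (i : ι) (k : ℕ) (u : Fin n → ℝ) (z : Fin n → ℤ) : ℝ :=
  (facet K v c i).indicator h
    ((k : ℝ)⁻¹ • (toReal z + toReal (-⌈-pairing (v i) u⌉ • e i))) -
  slabExtension K v c h i k ((k : ℝ)⁻¹ • (toReal z + u))

theorem abs_slabExtension_le (hh : HasSecondOrderBound K h M) (hne : K.Nonempty) (i : ι) (k : ℕ)
    (x : Fin n → ℝ) : |slabExtension K v c h i k x| ≤ M := by
  rw [slabExtension, Set.indicator_apply]
  split_ifs
  · exact hh.abs_indicator_le hne (facet_subset i) _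
  · rw [abs_zero]; exact hh.nonneg hne

theorem abs_facetDefect_le (hh : HasSecondOrderBound K h M) (hne : K.Nonempty) (i : ι) (k : ℕ)
    (u : Fin n → ℝ) (z : Fin n → ℤ) : |facetDefect K v e c h i k u z| ≤ 2 * M := by
  refine (abs_sub _ _).trans ?_
  have h1 := hh.abs_indicator_le hne (facet_subset (v := v) (c := c) i)
    ((k : ℝ)⁻¹ • (toReal z + toReal (-⌈-pairing (v i) u⌉ • e i)))
  have h2 := abs_slabExtension_le hh hne (v := v) (c := c) i k ((k : ℝ)⁻¹ • (toReal z + u))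
  linarith

theorem facetFun_scaled {i : ι} (hc : sInf ((fun y => toReal (v i) ⬝ᵥ y) '' K) = c i) {k : ℕ}
    (hk : 1 ≤ k) (z : Fin n → ℤ) (u : Fin n → ℝ) :
    k * facetFun K (v i) ((k : ℝ)⁻¹ • (toReal z + u)) =
      level (v i) (c i) k z + pairing (v i) u := by
  rw [facetFun, hc, ← pairing_apply, pairing_scaled _ hk]

theorem DisplacementBounds.facetDefect_eq_zero (hb : DisplacementBounds v e N₁ N D) {i : ι}
    (hc : sInf ((fun y => toReal (v i) ⬝ᵥ y) '' K) = c i) {k : ℕ} (hk : 1 ≤ k)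
    {u : Fin n → ℝ} {z : Fin n → ℤ} (hz : level (v i) (c i) k z ≠ ⌈-pairing (v i) u⌉) :
    facetDefect K v e c h i k u z = 0 := by
  rw [facetDefect, hb.facet_indicator_eq_zero hk hz, slabExtension,
    Set.indicator_of_notMem, sub_zero]
  rintro ⟨h0, h1⟩
  rw [facetFun_scaled hc hk] at h0 h1
  refine hz (Eq.symm (Int.ceil_eq_iff.2 ⟨?_, ?_⟩)) <;> linarith

theorem DisplacementBounds.abs_ceil_le (hb : DisplacementBounds v e N₁ N D) (i : ι)
    {u : Fin n → ℝ} (hu : u ∈ unitCube n) : |⌈-pairing (v i) u⌉| ≤ N₁ := by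
  have h1 := abs_le.1 (hb.cube i u hu)
  rw [abs_le]
  constructor
  · have h2 := Int.le_ceil (-pairing (v i) u)
    have h3 : ((-(N₁ : ℤ) : ℤ) : ℝ) ≤ ⌈-pairing (v i) u⌉ := by push_cast; linarith
    exact_mod_cast h3
  · exact Int.ceil_le.2 (by push_cast; linarith)

theorem DisplacementBounds.facetDefect_eq_zero_of_far (hb : DisplacementBounds v e N₁ N D)
    {i : ι} (hc : sInf ((fun y => toReal (v i) ⬝ᵥ y) '' K) = c i) {k : ℕ} (hk : 1 ≤ k)
    {u : Fin n → ℝ} (hu : u ∈ unitCube n) {z : Fin n → ℤ}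
    (hz : (N : ℤ) < |level (v i) (c i) k z|) : facetDefect K v e c h i k u z = 0 := by
  refine hb.facetDefect_eq_zero hc hk fun heq => ?_
  rw [heq] at hz
  have h1 := hb.abs_ceil_le i hu
  have h2 := hb.le
  omega

/-- On the relevant level, both terms of the defect are values of `h` at nearby points of the facet
`i`: the lattice point translated along `e i`, and the projection of the displaced point. -/
theorem IsFacetSystem.abs_facetDefect_le_of_far_except (hF : IsFacetSystem K v c)
    (hb : DisplacementBounds v e N₁ N D) (hh : HasSecondOrderBound K h M) (hne : K.Nonempty)
    {i : ι} (hc : sInf ((fun y => toReal (v i) ⬝ᵥ y) '' K) = c i) {k : ℕ} (hk : 1 ≤ k)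
    {u : Fin n → ℝ} (hu : u ∈ unitCube n) {z : Fin n → ℤ}
    (hz : ∀ j, j ≠ i → (N : ℤ) < |level (v j) (c j) k z|) :
    |facetDefect K v e c h i k u z| ≤ 2 * M * D / k := by
  have hM := hh.nonneg hne
  have hk' : (0 : ℝ) < k := by exact_mod_cast hk
  have hbound : 0 ≤ 2 * M * D / k := by positivity
  by_cases heq : level (v i) (c i) k z = ⌈-pairing (v i) u⌉
  swap
  · rw [hb.facetDefect_eq_zero hc hk heq, abs_zero]; exact hbound
  set J := ⌈-pairing (v i) u⌉ with hJ
  have hJ1 := hb.abs_ceil_le i hu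
  set s : ℝ := level (v i) (c i) k z + pairing (v i) u with hs
  have hs0 : 0 ≤ s := by
    have := Int.le_ceil (-pairing (v i) u)
    rw [hs, heq]; linarith
  have hs1 : s < 1 := by
    have := Int.ceil_lt_add_one (-pairing (v i) u)
    rw [hs, heq]; linarith
  have hvi := one_le_pairing_self (ne_zero_of_gcd_eq_one (hF.gcd_eq_one i))
  -- Projecting the displaced point to the facet hyperplane subtracts `q • v i` from `u`.
  set q : ℝ := s / pairing (v i) (toReal (v i)) with hq
  have hq0 : 0 ≤ q := by positivity
  have hq1 : q ≤ 1 := (div_le_one (by linarith)).2 (by linarith)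
  set d : Fin n → ℝ := u - q • toReal (v i) with hd
  have hslab : (k : ℝ)⁻¹ • (toReal z + u) ∈
      {x | 0 ≤ k * facetFun K (v i) x ∧ k * facetFun K (v i) x < 1} := by
    rw [Set.mem_ofPred_eq, facetFun_scaled hc hk]
    exact ⟨hs0, hs1⟩
  have hproj : facetProj K (v i) ((k : ℝ)⁻¹ • (toReal z + u)) = (k : ℝ)⁻¹ • (toReal z + d) := by
    have h1 : facetFun K (v i) ((k : ℝ)⁻¹ • (toReal z + u)) = (k : ℝ)⁻¹ * s := by
      rw [hs, ← facetFun_scaled hc hk, inv_mul_cancel_left₀ hk'.ne']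
    rw [facetProj, h1, ← pairing_apply, mul_div_assoc, ← hq, hd]
    module
  have hdpair : ∀ j, |pairing (v j) d| ≤ N := fun j => by
    rw [hd, map_sub, map_smul, smul_eq_mul]
    refine (abs_sub _ _).trans ((add_le_add (hb.cube j u hu) ?_).trans (hb.normal i j))
    rw [abs_mul, abs_of_nonneg hq0]
    exact mul_le_of_le_one_left (abs_nonneg _) hq1
  have hdi : (level (v i) (c i) k z : ℝ) + pairing (v i) d = 0 := by
    rw [hd, map_sub, map_smul, smul_eq_mul, hq, div_mul_cancel₀ _ (by linarith), hs]
    ring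
  have hdn : ‖d‖ ≤ D := by
    refine (norm_sub_le _ _).trans ((add_le_add (norm_le_one_of_mem_unitCube hu) ?_).trans
      (hb.norm_normal i))
    rw [norm_smul, Real.norm_eq_abs, abs_of_nonneg hq0]
    exact mul_le_of_le_one_left (norm_nonneg _) hq1
  have htpair := fun j => hb.abs_pairing_transversal_le i j hJ1
  have hti : (level (v i) (c i) k z : ℝ) + pairing (v i) (toReal (-J • e i)) = 0 := by
    rw [hb.pairing_transversal, heq]; ring
  have hiff : ∀ {d : Fin n → ℝ}, (∀ j, |pairing (v j) d| ≤ N) →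
      (level (v i) (c i) k z : ℝ) + pairing (v i) d = 0 →
      ((k : ℝ)⁻¹ • (toReal z + d) ∈ facet K v c i ↔
        ∀ j, j ≠ i → 0 < level (v j) (c j) k z) := fun h1 h2 => by
    rw [scaled_mem_facet_iff hk, hF.scaled_mem_iff_of_far_except hk hz h1, h2]
    simp
  rw [facetDefect, slabExtension, Set.indicator_of_mem hslab, hproj]
  by_cases hpos : ∀ j, j ≠ i → 0 < level (v j) (c j) k z
  · have m1 := (hiff htpair hti).2 hpos
    have m2 := (hiff hdpair hdi).2 hpos
    rw [Set.indicator_of_mem m1, Set.indicator_of_mem m2]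
    exact hh.abs_scaled_sub_le hne (facet_subset i m1) (facet_subset i m2)
      (hb.norm_transversal_le i hJ1) hdn
  · rw [Set.indicator_of_notMem fun hm => hpos ((hiff htpair hti).1 hm),
      Set.indicator_of_notMem fun hm => hpos ((hiff hdpair hdi).1 hm), sub_zero, abs_zero]
    exact hbound

/-- The lattice sum over a facet is given up to `O(k ^ (n - 2))` by the integral over the facet. -/
theorem IsFacetSystem.exists_abs_facet_sum_le [Fintype ι] (hF : IsFacetSystem K v c)
    (hh : HasSecondOrderBound K h M) (hK : IsCompact K) (hne : K.Nonempty)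
    (hcont : ContinuousOn h K) (i : ι)
    (hc : sInf ((fun y => toReal (v i) ⬝ᵥ y) '' K) = c i) : ∃ C : ℝ, ∀ᶠ k : ℕ in atTop,
      |∑ᶠ z : Fin n → ℤ, (facet K v c i).indicator h ((k : ℝ)⁻¹ • toReal z) -
        (k : ℝ) ^ n * ∫ x, slabExtension K v c h i k x| * (k : ℝ) ^ 2 ≤ C * (k : ℝ) ^ n := by
  obtain ⟨e, N₁, N, D, hb⟩ := hF.exists_displacementBounds
  obtain ⟨ρ, hρ⟩ := hK.isBounded.exists_norm_le
  have hM := hh.nonneg hne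
  have hvi : v i ≠ 0 := ne_zero_of_gcd_eq_one (hF.gcd_eq_one i)
  obtain ⟨R₀, hR₀⟩ := exists_nat_ge (ρ + ‖toReal (v i)‖ + D)
  obtain ⟨R, hR, hR1⟩ : ∃ R : ℕ, ρ + ‖toReal (v i)‖ + D ≤ R ∧ 1 ≤ R :=
    ⟨R₀ + 1, by push_cast; linarith, by omega⟩
  have hsuppF : ∀ x, (facet K v c i).indicator h x ≠ 0 → ‖x‖ ≤ ρ := fun x hx =>
    hρ x (facet_subset i (Set.mem_of_indicator_ne_zero hx))
  have hD1 : (1 : ℝ) ≤ D := by exact_mod_cast hb.one_le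
  have hnorm := norm_nonneg (toReal (v i))
  obtain ⟨C, hC⟩ := hF.exists_abs_sum_le hR1 N (2 * M + 2 * M * D)
  refine ⟨C, ?_⟩
  filter_upwards [hC, eventually_ge_atTop 1] with k hCk hk
  have hk' : (0 : ℝ) < k := by exact_mod_cast hk
  have hk1 : (1 : ℝ) ≤ k := by exact_mod_cast hk
  have hk2 : (0 : ℝ) < (k : ℝ) ^ 2 := by positivity
  have hsupp : ∀ x, slabExtension K v c h i k x ≠ 0 → ‖x‖ ≤ ρ + ‖toReal (v i)‖ := by
    intro x hx
    have hmem := Set.mem_of_indicator_ne_zero hx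
    rw [slabExtension, Set.indicator_of_mem hmem] at hx
    have h0 : 0 ≤ facetFun K (v i) x := nonneg_of_mul_nonneg_right hmem.1 hk'
    have h1 : facetFun K (v i) x ≤ 1 := by
      have := hmem.2
      nlinarith
    exact norm_le_of_facetProj_mem hρ hvi h0 h1
      (facet_subset i (Set.mem_of_indicator_ne_zero hx))
  obtain ⟨hi1, he1⟩ := pow_mul_integral_eq (integrable_slabExtension hK hcont hvi hk) hsupp hk
    (R := R) (by linarith)
  set T := ∑ᶠ z : Fin n → ℤ, (facet K v c i).indicator h ((k : ℝ)⁻¹ • toReal z) with hT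
  have hint : T - (k : ℝ) ^ n * ∫ x, slabExtension K v c h i k x =
      ∫ u in unitCube n, (T - ∑ z ∈ latticeBox n (R * k),
        slabExtension K v c h i k ((k : ℝ)⁻¹ • (toReal z + u))) := by
    rw [integral_sub (integrableOn_unitCube_const _)
      hi1, setIntegral_unitCube_const, he1]
  rw [← le_div_iff₀ hk2, hint]
  refine abs_setIntegral_unitCube_le (Eventually.of_forall fun u hu => ?_)
  have hsum : T - ∑ z ∈ latticeBox n (R * k),
      slabExtension K v c h i k ((k : ℝ)⁻¹ • (toReal z + u)) =
      ∑ z ∈ latticeBox n (R * k), facetDefect K v e c h i k u z := by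
    simp only [facetDefect, Finset.sum_sub_distrib]
    rw [sum_latticeBox_add hsuppF hk (by linarith) (hb.abs_toReal_le i (hb.abs_ceil_le i hu))]
  rw [hsum, le_div_iff₀ hk2]
  have hBD : 0 ≤ 2 * M * D := by positivity
  refine hCk _ (fun z => ?_) (fun z i' hz => ?_) fun z hz => ?_
  · exact (abs_facetDefect_le hh hne i k u z).trans (by linarith)
  · by_cases hii : i' = i
    · subst hii
      exact (hF.abs_facetDefect_le_of_far_except hb hh hne hc hk hu hz).trans
        (div_le_div_of_nonneg_right (by linarith) hk'.le)
    · rw [hb.facetDefect_eq_zero_of_far hc hk hu (hz i fun h => hii h.symm), abs_zero]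
      positivity
  · rw [hb.facetDefect_eq_zero_of_far hc hk hu (hz i), abs_zero]
    positivity

/-! ### Functions of class `C²` on a compact convex set -/

/-- First-order Taylor estimate with a uniform quadratic remainder up to the boundary. -/
theorem exists_abs_taylor_le {K : Set (Fin n → ℝ)} (hK : IsCompact K) (hconv : Convex ℝ K)
    (hne : (interior K).Nonempty) {h : (Fin n → ℝ) → ℝ} (hC2 : ContDiffOn ℝ 2 h K) :
    ∃ L : ℝ, 0 ≤ L ∧ ∀ x ∈ K, ∀ y ∈ K,
      |h y - h x - fderivWithin ℝ h K x (y - x)| ≤ L * ‖y - x‖ ^ 2 := by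
  have hderiv : ContDiffOn ℝ 1 (fderivWithin ℝ h K) K :=
    hC2.fderivWithin (uniqueDiffOn_convex hconv hne) (by norm_num)
  obtain ⟨L, hL⟩ := hderiv.exists_lipschitzOnWith one_ne_zero hconv hK
  refine ⟨L, L.2, fun x hx y hy => ?_⟩
  have hseg : segment ℝ x y ⊆ K := hconv.segment_subset hx hy
  have h1 := (convex_segment x y).norm_image_sub_le_of_norm_hasFDerivWithin_le'
    (f := h) (f' := fderivWithin ℝ h K) (φ := fderivWithin ℝ h K x) (C := L * ‖y - x‖)
    (fun w hw => ((hC2.differentiableOn (by norm_num) w (hseg hw)).hasFDerivWithinAt).mono hseg)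
    (fun w hw => (hL.norm_sub_le (hseg hw) hx).trans
      (mul_le_mul_of_nonneg_left (norm_sub_le_of_mem_segment hw) L.2))
    (left_mem_segment ℝ x y) (right_mem_segment ℝ x y)
  rw [Real.norm_eq_abs] at h1
  exact h1.trans (le_of_eq (by ring))

theorem exists_hasSecondOrderBound {K : Set (Fin n → ℝ)} (hK : IsCompact K)
    (hconv : Convex ℝ K) (hne : (interior K).Nonempty) {h : (Fin n → ℝ) → ℝ}
    (hC2 : ContDiffOn ℝ 2 h K) : ∃ M, HasSecondOrderBound K h M := by
  obtain ⟨B, hB⟩ := hK.exists_bound_of_continuousOn hC2.continuousOn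
  obtain ⟨L, hL⟩ := hC2.exists_lipschitzOnWith two_ne_zero hconv hK
  obtain ⟨Q, hQ0, hQ⟩ := exists_abs_taylor_le hK hconv hne hC2
  have hLnn : (0 : ℝ) ≤ L := L.2
  obtain ⟨x₀, hx₀⟩ := hne.mono interior_subset
  have hB0 : 0 ≤ B := (norm_nonneg _).trans (hB x₀ hx₀)
  refine ⟨B + L + Q, fun x hx => (hB x hx).trans (by linarith), fun x hx y hy => ?_,
    fun x d hx hxd hxd' => ?_⟩
  · refine (hL.norm_sub_le hx hy).trans (mul_le_mul_of_nonneg_right ?_ (norm_nonneg _))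
    linarith
  · have h1 := hQ x hx _ hxd
    have h2 := hQ x hx _ hxd'
    rw [add_sub_cancel_left] at h1 h2
    rw [map_neg, norm_neg] at h2
    have h3 : Q * ‖d‖ ^ 2 ≤ (B + L + Q) * ‖d‖ ^ 2 :=
      mul_le_mul_of_nonneg_right (by linarith) (by positivity)
    rw [abs_le] at h1 h2 ⊢
    constructor <;> linarith [h1.1, h1.2, h2.1, h2.2]

/-! ### The boundary measure -/

theorem IsIntegerPolytope.exists_vertices {P : Set (Fin n → ℝ)} (hP : IsIntegerPolytope P) :
    ∃ V : Finset (Fin n → ℤ), closure P = convexHull ℝ (toReal '' (V : Set (Fin n → ℤ))) ∧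
      interior (closure P) = P := by
  obtain ⟨hne, V, rfl⟩ := hP
  have hconv : Convex ℝ (convexHull ℝ (toReal '' (V : Set (Fin n → ℤ)))) := convex_convexHull ℝ _
  have hclosed : IsClosed (convexHull ℝ (toReal '' (V : Set (Fin n → ℤ)))) :=
    ((V.finite_toSet.image _).isCompact_convexHull ℝ).isClosed
  have h1 := hconv.closure_interior_eq_closure_of_nonempty_interior hne
  rw [hclosed.closure_eq] at h1
  exact ⟨V, h1, by rw [h1]⟩

/-- An integer polytope is described by the inequalities of its facets. -/
theorem isFacetSystem_of_convexHull {V : Finset (Fin n → ℤ)} {K : Set (Fin n → ℝ)}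
    (hK : K = convexHull ℝ (toReal '' (V : Set (Fin n → ℤ)))) (hne : (interior K).Nonempty) :
    ∃ c : {v : Fin n → ℤ // IsPrimitiveFacetNormal K v} → ℤ,
      (∀ i, sInf ((fun y => toReal i.1 ⬝ᵥ y) '' K) = c i) ∧
      IsFacetSystem K (fun i : {v : Fin n → ℤ // IsPrimitiveFacetNormal K v} => i.1) c := by
  choose c hc hc' using fun i : {v : Fin n → ℤ // IsPrimitiveFacetNormal K v} =>
    exists_isLeast_pairing hK (hne.mono interior_subset) i.1
  refine ⟨c, hc, fun x => ⟨fun hx i => hc' i x hx, fun hx => ?_⟩, fun i => i.2.1,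
    fun i j hij => ?_⟩
  · by_contra hxK
    obtain ⟨v, hv, hlt⟩ := exists_facet_of_notMem hK hne hxK
    have h1 := hx ⟨v, hv⟩
    rw [facetFun, hc ⟨v, hv⟩, ← pairing_apply] at hlt
    linarith
  · refine (facets_transversal_or_opposite hK hne i.2.1 j.2.1
      fun h => hij (Subtype.ext h)).imp_right fun h => ⟨h.1, ?_⟩
    have h2 := h.2
    rw [hc i, hc j] at h2
    exact_mod_cast h2

theorem face_eq_facet {K : Set (Fin n → ℝ)} {ι : Type*} {v : ι → Fin n → ℤ} {c : ι → ℤ} {i : ι}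
    (hc : sInf ((fun y => toReal (v i) ⬝ᵥ y) '' K) = c i) : face K (v i) = facet K v c i := by
  ext x
  exact and_congr_right fun _ => by rw [facetFun, hc, sub_eq_zero, pairing_apply]

/-- An integral over a facet is an integral over a slab of width one, by the definition of the facet
measure as a projection. -/
theorem integrable_and_integral_facetMeasure {K : Set (Fin n → ℝ)} (hK : IsCompact K)
    {h : (Fin n → ℝ) → ℝ} (hcont : ContinuousOn h K) {ι : Type*} {v : ι → Fin n → ℤ} {c : ι → ℤ}
    {i : ι} (hc : sInf ((fun y => toReal (v i) ⬝ᵥ y) '' K) = c i) (hv : v i ≠ 0) :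
    Integrable h (facetMeasure K (v i)) ∧ ∫ x, h x ∂(facetMeasure K (v i)) =
      ∫ x in {x | 0 ≤ facetFun K (v i) x ∧ facetFun K (v i) x ≤ 1},
        (facet K v c i).indicator h (facetProj K (v i) x) := by
  have hmeas : MeasurableSet (facet K v c i) := (isCompact_facet hK i).measurableSet
  have hproj : AEMeasurable (facetProj K (v i)) (volume.restrict
      {x | 0 ≤ facetFun K (v i) x ∧ facetFun K (v i) x ≤ 1}) :=
    (continuous_facetProj K (v i)).measurable.aemeasurable
  have hsm : AEStronglyMeasurable ((facet K v c i).indicator h) ((volume.restrict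
      {x | 0 ≤ facetFun K (v i) x ∧ facetFun K (v i) x ≤ 1}).map (facetProj K (v i))) :=
    (aestronglyMeasurable_indicator_iff hmeas).2
      ((hcont.mono (facet_subset i)).aestronglyMeasurable hmeas)
  rw [facetMeasure, face_eq_facet hc]
  constructor
  · rw [← IntegrableOn, ← integrable_indicator_iff hmeas, integrable_map_measure hsm hproj]
    exact integrableOn_slab hK hcont hv
  · rw [← integral_indicator hmeas, integral_map hproj hsm]

theorem face_subset_frontier {P : Set (Fin n → ℝ)} (hP : interior (closure P) = P)
    {v : Fin n → ℤ} (hv : v ≠ 0) {c : ℤ}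
    (hc : sInf ((fun y => toReal v ⬝ᵥ y) '' closure P) = c)
    (hle : ∀ x ∈ closure P, (c : ℝ) ≤ pairing v x) : face (closure P) v ⊆ frontier P := by
  intro x hx
  have hopen : IsOpen P := hP ▸ isOpen_interior
  rw [hopen.frontier_eq]
  refine ⟨hx.1, fun hxP => ?_⟩
  rw [← hP] at hxP
  have h1 := lt_pairing_of_mem_interior hv hle hxP
  rw [pairing_eq_of_mem_face hx, hc] at h1
  exact lt_irrefl _ h1

theorem setIntegral_frontier_boundaryMeasure {P : Set (Fin n → ℝ)} (hP : interior (closure P) = P)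
    [Fintype {v : Fin n → ℤ // IsPrimitiveFacetNormal (closure P) v}]
    (hK : IsCompact (closure P)) {h : (Fin n → ℝ) → ℝ} (hcont : ContinuousOn h (closure P))
    {c : {v : Fin n → ℤ // IsPrimitiveFacetNormal (closure P) v} → ℤ}
    (hc : ∀ i, sInf ((fun y => toReal i.1 ⬝ᵥ y) '' closure P) = c i)
    (hF : IsFacetSystem (closure P) (fun i => i.1) c) :
    ∫ x in frontier P, h x ∂(boundaryMeasure P) =
      ∑ i : {v : Fin n → ℤ // IsPrimitiveFacetNormal (closure P) v},
        ∫ x in {x | 0 ≤ facetFun (closure P) i.1 x ∧ facetFun (closure P) i.1 x ≤ 1},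
          (facet (closure P) (fun i => i.1) c i).indicator h (facetProj (closure P) i.1 x) := by
  have hfr : MeasurableSet (frontier P) := isClosed_frontier.measurableSet
  have hres : ∀ i : {v : Fin n → ℤ // IsPrimitiveFacetNormal (closure P) v},
      (facetMeasure (closure P) i.1).restrict (frontier P) = facetMeasure (closure P) i.1 := by
    intro i
    rw [facetMeasure, Measure.restrict_restrict hfr, Set.inter_eq_right.2]
    exact face_subset_frontier hP (ne_zero_of_gcd_eq_one i.2.1) (hc i)
      fun x hx => (hF.mem_iff x).1 hx i
  rw [boundaryMeasure, Measure.restrict_sum _ hfr]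
  simp_rw [hres]
  rw [Measure.sum_fintype, integral_finsetSum_measure]
  · exact Finset.sum_congr rfl fun i _ =>
      (integrable_and_integral_facetMeasure hK hcont (v := fun i : {v : Fin n → ℤ //
        IsPrimitiveFacetNormal (closure P) v} => i.1) (hc i)
        (ne_zero_of_gcd_eq_one i.2.1)).2
  · exact fun i _ => (integrable_and_integral_facetMeasure hK hcont (v := fun i :
      {v : Fin n → ℤ // IsPrimitiveFacetNormal (closure P) v} => i.1) (hc i)
      (ne_zero_of_gcd_eq_one i.2.1)).1

theorem finsum_scaledLattice (K : Set (Fin n → ℝ)) (h : (Fin n → ℝ) → ℝ) {k : ℕ} (hk : 1 ≤ k) :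
    ∑ᶠ p ∈ K ∩ scaledLattice n k, h p =
      ∑ᶠ z : Fin n → ℤ, K.indicator h ((k : ℝ)⁻¹ • toReal z) := by
  have hk' : (k : ℝ) ≠ 0 := by positivity
  have hinj : Function.Injective fun z : Fin n → ℤ => (k : ℝ)⁻¹ • toReal z := by
    intro z z' hz
    have h1 := smul_right_injective _ (inv_ne_zero hk') hz
    ext i
    have h2 := congrFun h1 i
    simp only [toReal] at h2
    exact_mod_cast h2
  have hrange : scaledLattice n k = Set.range fun z : Fin n → ℤ => (k : ℝ)⁻¹ • toReal z := by
    ext x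
    refine exists_congr fun z => ?_
    have h1 : (fun i => (z i : ℝ) / (k : ℝ)) = (k : ℝ)⁻¹ • toReal z := by
      ext i
      simp [toReal, div_eq_inv_mul]
    rw [h1]
    exact eq_comm
  rw [← finsum_mem_range hinj, ← hrange, finsum_mem_def, finsum_mem_def, Set.indicator_indicator,
    Set.inter_comm]

/-! ### The asymptotic expansion -/

/-- The expansion, in a form that avoids negative powers of `k` in dimensions zero and one. -/
theorem exists_abs_lattice_sum_sub_le {P : Set (Fin n → ℝ)} (hP : IsIntegerPolytope P)
    {h : (Fin n → ℝ) → ℝ} (hC2 : ContDiffOn ℝ 2 h (closure P)) :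
    ∃ C : ℝ, ∀ᶠ k : ℕ in atTop,
      |(∑ᶠ p ∈ closure P ∩ scaledLattice n k, h p) - ((∫ x in P, h x) * (k : ℝ) ^ n +
        (1 / 2 * ∫ x in frontier P, h x ∂(boundaryMeasure P)) * ((k : ℝ) ^ n / k))| *
        (k : ℝ) ^ 2 ≤ C * (k : ℝ) ^ n := by
  obtain ⟨V, hV, hint⟩ := hP.exists_vertices
  have hne : (interior (closure P)).Nonempty := hint.symm ▸ hP.1
  have hKne : (closure P).Nonempty := hP.1.closure
  have hK : IsCompact (closure P) := hV ▸ (V.finite_toSet.image _).isCompact_convexHull ℝ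
  have hconv : Convex ℝ (closure P) := hV ▸ convex_convexHull ℝ _
  have hcont := hC2.continuousOn
  have hfin : Finite {v : Fin n → ℤ // IsPrimitiveFacetNormal (closure P) v} :=
    (finite_facetNormals hV hne).to_subtype
  have := Fintype.ofFinite {v : Fin n → ℤ // IsPrimitiveFacetNormal (closure P) v}
  obtain ⟨c, hc, hF⟩ := isFacetSystem_of_convexHull hV hne
  obtain ⟨M, hh⟩ := exists_hasSecondOrderBound hK hconv hne hC2
  obtain ⟨C, hC⟩ := hF.exists_abs_trapezoid_le hh hK hKne hcont
  choose C' hC' using fun i => hF.exists_abs_facet_sum_le hh hK hKne hcont i (hc i)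
  -- The boundary of a convex set has measure zero.
  have hvol : ∫ x in P, h x = ∫ x in closure P, h x := by
    have h1 := setIntegral_congr_set (μ := volume) (f := h)
      (interior_ae_eq_of_null_frontier (hconv.addHaar_frontier volume))
    rwa [hint] at h1
  refine ⟨C + 1 / 2 * ∑ i, C' i, ?_⟩
  filter_upwards [hC, eventually_all.2 hC', eventually_ge_atTop 1] with k h1 h2 hk
  have hk' : (0 : ℝ) < k := by exact_mod_cast hk
  rw [finsum_scaledLattice _ _ hk, hvol, setIntegral_frontier_boundaryMeasure hint hK hcont hc hF]
  have h3 := fun i => mul_integral_slabExtension (K := closure P) (h := h)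
    (v := fun i : {v : Fin n → ℤ // IsPrimitiveFacetNormal (closure P) v} => i.1) (c := c)
    hK hcont (ne_zero_of_gcd_eq_one (hF.gcd_eq_one i)) hk
  simp_rw [← h3]
  set S := ∑ᶠ z : Fin n → ℤ, (closure P).indicator h ((k : ℝ)⁻¹ • toReal z)
  set I := ∫ x in closure P, h x
  set T := fun i => ∑ᶠ z : Fin n → ℤ,
    (facet (closure P) (fun i : {v : Fin n → ℤ // IsPrimitiveFacetNormal (closure P) v} => i.1)
      c i).indicator h ((k : ℝ)⁻¹ • toReal z)
  set s := fun i => ∫ x, slabExtension (closure P)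
    (fun i : {v : Fin n → ℤ // IsPrimitiveFacetNormal (closure P) v} => i.1) c h i k x
  have hsplit : S - (I * (k : ℝ) ^ n + (1 / 2 * ∑ i, (k : ℝ) * s i) * ((k : ℝ) ^ n / k)) =
      (S - (k : ℝ) ^ n * I - 1 / 2 * ∑ i, T i) + 1 / 2 * ∑ i, (T i - (k : ℝ) ^ n * s i) := by
    rw [Finset.sum_sub_distrib, ← Finset.mul_sum, ← Finset.mul_sum]
    field_simp
    ring
  have h4 : |∑ i, (T i - (k : ℝ) ^ n * s i)| * (k : ℝ) ^ 2 ≤ (∑ i, C' i) * (k : ℝ) ^ n := by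
    rw [Finset.sum_mul]
    refine (mul_le_mul_of_nonneg_right (Finset.abs_sum_le_sum_abs _ _) (by positivity)).trans ?_
    rw [Finset.sum_mul]
    exact Finset.sum_le_sum fun i _ => h2 i
  rw [hsplit]
  calc _ ≤ (|S - (k : ℝ) ^ n * I - 1 / 2 * ∑ i, T i| +
        |1 / 2 * ∑ i, (T i - (k : ℝ) ^ n * s i)|) * (k : ℝ) ^ 2 :=
        mul_le_mul_of_nonneg_right (abs_add_le _ _) (by positivity)
    _ = |S - (k : ℝ) ^ n * I - 1 / 2 * ∑ i, T i| * (k : ℝ) ^ 2 +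
        1 / 2 * (|∑ i, (T i - (k : ℝ) ^ n * s i)| * (k : ℝ) ^ 2) := by
      rw [abs_mul, abs_of_pos (by norm_num : (0 : ℝ) < 1 / 2)]; ring
    _ ≤ C * (k : ℝ) ^ n + 1 / 2 * ((∑ i, C' i) * (k : ℝ) ^ n) := by linarith [h1, h4]
    _ = _ := by ring

end LatticeSum

theorem mainTheorem3 (n : ℕ) (P : Set (Fin n → ℝ)) (hP : LatticeSum.IsIntegerPolytope P)
    (h : (Fin n → ℝ) → ℝ) (hconv : ConvexOn ℝ (closure P) h)
    (hC2 : ContDiffOn ℝ 2 h (closure P)) :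
    (fun k : ℕ =>
        (∑ᶠ p ∈ closure P ∩ LatticeSum.scaledLattice n k, h p) -
          ((∫ x in P, h x) * (k : ℝ) ^ (n : ℤ) +
            ((1 / 2 : ℝ) * ∫ x in frontier P, h x ∂(LatticeSum.boundaryMeasure P)) *
              (k : ℝ) ^ ((n : ℤ) - 1)))
      =O[atTop] (fun k : ℕ => (k : ℝ) ^ ((n : ℤ) - 2)) := by
  obtain ⟨C, hC⟩ := LatticeSum.exists_abs_lattice_sum_sub_le hP hC2
  refine IsBigO.of_bound C ?_
  filter_upwards [hC, eventually_ge_atTop 1] with k hk hk1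
  have hk' : (0 : ℝ) < k := by exact_mod_cast hk1
  rw [Real.norm_eq_abs, Real.norm_eq_abs,
    abs_of_pos (by positivity : (0 : ℝ) < (k : ℝ) ^ ((n : ℤ) - 2)), zpow_sub₀ hk'.ne',
    zpow_sub₀ hk'.ne', zpow_natCast, zpow_one, ← mul_div_assoc C,
    le_div_iff₀ (by positivity)]
  exact hk
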